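/- Let $P$ be a finite graded simplicial poset of rank $n$, that is, a finite poset with least element $\hat 0$ such that for every maximal element $m$ the interval $[\hat 0,m]$ is a Boolean lattice of rank $n$. Assume that $P$ has positive $h$-vector: if $f_{i-1}$ is the number of elements of rank $i$ of $P$ and $h_0+h_1x+\dots+h_nx^n=\sum_{i=0}^n f_{i-1}x^i(1-x)^{n-i}$, then $h_i\ge 0$ for all $i$. Let $\widehat P$ be the poset obtained from $P$ by adding a top element $\hat 1$, and let $\widehat P^\ast$ be its dual poset. For a finite graded poset $Q$ of rank $n+1$ with least and greatest element and $T\subseteq\{1,\dots,n\}$, let $\alpha_Q(T)$ be the number of maximal chains of the subposet of elements whose rank lies in $T$, and put $\beta_Q(S)=\sum_{T\subseteq S}(-1)^{|S\setminus T|}\alpha_Q(T)$. Call $S\subset\mathbb Z$ isolated if $i\in S$ implies $i+1\notin S$. The Chow polynomial and the augmented Chow polynomial of $Q$ are $$\mathrm H_Q(x)=\sum_{\substack{S\subseteq\{2,\dots,n\}\\ S\text{ isolated}}}\beta_Q(S)\,x^{|S|}(1+x)^{n-2|S|},\qquad \mathrm H^{\mathrm{aug}}_Q(x)=\sum_{\substack{S\subseteq\{1,\dots,n\}\\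 S\text{ isolated}}}\beta_Q(S)\,x^{|S|}(1+x)^{n+1-2|S|}.$$ Then $\mathrm H_{\widehat P^\ast}(x)$ has only real roots. Moreover, $\mathrm H^{\mathrm{aug}}_{\widehat P^\ast}(x)=\mathrm H^{\mathrm{aug}}_{\widehat P}(x)$, and $\mathrm H_{\widehat P^\ast}(x)$ interlaces this polynomial: both are nonzero polynomials with nonnegative coefficients and only real roots, $\deg \mathrm H^{\mathrm{aug}}_{\widehat P^\ast}-\deg\mathrm H_{\widehat P^\ast}\in\{0,1\}$, and the roots $\alpha_1\ge\alpha_2\ge\cdots$ of $\mathrm H_{\widehat P^\ast}$ and $\beta_1\ge\beta_2\ge\cdots$ of $\mathrm H^{\mathrm{aug}}_{\widehat P^\ast}$, listed with multiplicity, satisfy $\beta_1\ge\alpha_1\ge\beta_2\ge\alpha_2\ge\cdots$. -/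

import Mathlib

open Polynomial

/-- A poset `P` with least element is a graded simplicial poset of rank `n` if every maximal
interval, i.e. every interval `[⊥, m]` with `m` a maximal element, is a Boolean lattice of
rank `n`. -/
def IsGradedSimplicial (P : Type*) [PartialOrder P] [OrderBot P] (n : ℕ) : Prop :=
  ∀ m : P, IsMax m → Nonempty (Set.Icc ⊥ m ≃o Finset (Fin n))

/-- The number of elements of rank `i` (this is `f_{i-1}` in the usual notation); the rank of an
element is the maximal length of a chain that ends in it. -/
noncomputable def numOfRank (P : Type*) [PartialOrder P] (i : ℕ) : ℕ :=
  Nat.card {x : P // Order.height x = (i : ℕ∞)}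

/-- The generating polynomial `h_0 + h_1 X + ⋯ + h_n X ^ n` of the `h`-vector of a graded
simplicial poset of rank `n`. -/
noncomputable def hPolynomial (P : Type*) [PartialOrder P] (n : ℕ) : ℤ[X] :=
  ∑ i ∈ Finset.range (n + 1), (numOfRank P i : ℤ[X]) * X ^ i * (1 - X) ^ (n - i)

/-- The entry `h_i` of the `h`-vector of a graded simplicial poset of rank `n`. -/
noncomputable def hVector (P : Type*) [PartialOrder P] (n i : ℕ) : ℤ :=
  (hPolynomial P n).coeff i

/-- The `h`-vector `(h_0, …, h_n)` is positive: `h_i ≥ 0` for all `i`. -/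
def HasPositiveHVector (P : Type*) [PartialOrder P] (n : ℕ) : Prop :=
  ∀ i ≤ n, 0 ≤ hVector P n i

/-- The rank of a poset with greatest element. -/
noncomputable def posetRank (Q : Type*) [PartialOrder Q] [OrderTop Q] : ℕ :=
  (Order.height (⊤ : Q)).toNat

/-- The rank-selected subposet of the elements whose rank is in `T`. -/
abbrev RankSelected (Q : Type*) [PartialOrder Q] (T : Finset ℕ) : Type _ :=
  {x : Q // ∃ i ∈ T, Order.height x = (i : ℕ∞)}

/-- The flag `f`-vector `α_Q(T)`: the number of maximal chains of the rank-selected subposet.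
(`Flag` is Mathlib's type of maximal chains.) -/
noncomputable def flagF (Q : Type*) [PartialOrder Q] (T : Finset ℕ) : ℕ :=
  Nat.card (Flag (RankSelected Q T))

/-- The flag `h`-vector `β_Q(S) = ∑_{T ⊆ S} (-1) ^ |S \ T| α_Q(T)`. -/
noncomputable def flagH (Q : Type*) [PartialOrder Q] (S : Finset ℕ) : ℤ :=
  ∑ T ∈ S.powerset, (-1) ^ (S \ T).card * (flagF Q T : ℤ)

/-- A set of integers is isolated if it contains no two consecutive elements. -/
def IsIsolated (S : Finset ℕ) : Prop := ∀ i ∈ S, i + 1 ∉ S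

open Classical in
/-- The Chow polynomial of a finite graded bounded poset `Q`, of rank `n + 1`: the sum over
isolated `S ⊆ {2, …, n}` of `β_Q(S) x ^ |S| (1 + x) ^ (n - 2 |S|)`. Here `n = posetRank Q - 1`. -/
noncomputable def chowPolynomial (Q : Type*) [PartialOrder Q] [OrderTop Q] : ℝ[X] :=
  ∑ S ∈ (Finset.Icc 2 (posetRank Q - 1)).powerset with IsIsolated S,
    C (flagH Q S : ℝ) * X ^ S.card * (1 + X) ^ (posetRank Q - 1 - 2 * S.card)

open Classical in
/-- The augmented Chow polynomial of a finite graded bounded poset `Q`, of rank `n + 1`: the sum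
over isolated `S ⊆ {1, …, n}` of `β_Q(S) x ^ |S| (1 + x) ^ (n + 1 - 2 |S|)`. -/
noncomputable def augChowPolynomial (Q : Type*) [PartialOrder Q] [OrderTop Q] : ℝ[X] :=
  ∑ S ∈ (Finset.Icc 1 (posetRank Q - 1)).powerset with IsIsolated S,
    C (flagH Q S : ℝ) * X ^ S.card * (1 + X) ^ (posetRank Q - 2 * S.card)

/-- A real polynomial is real-rooted if all its complex roots are real
(the zero polynomial counts as real-rooted). -/
def IsRealRooted (f : ℝ[X]) : Prop :=
  f = 0 ∨ ∀ z : ℂ, aeval z f = 0 → z.im = 0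

/-- `f` interlaces `g`: both are nonzero polynomials with nonnegative coefficients and only real
roots, `α_1 ≥ α_2 ≥ ⋯` for `f` and `β_1 ≥ β_2 ≥ ⋯` for `g` (with multiplicity),
`deg g` is `deg f` or `deg f + 1`, and `β_1 ≥ α_1 ≥ β_2 ≥ α_2 ≥ ⋯`. -/
def Interlaces (f g : ℝ[X]) : Prop :=
  f ≠ 0 ∧ g ≠ 0 ∧ (∀ i, 0 ≤ f.coeff i) ∧ (∀ i, 0 ≤ g.coeff i) ∧
  ∃ (d e : ℕ) (α : Fin d → ℝ) (β : Fin e → ℝ),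
    Antitone α ∧ Antitone β ∧
    f = C f.leadingCoeff * ∏ i, (X - C (α i)) ∧
    g = C g.leadingCoeff * ∏ j, (X - C (β j)) ∧
    (e = d ∨ e = d + 1) ∧
    (∀ (i : Fin d) (j : Fin e), (j : ℕ) = i → α i ≤ β j) ∧
    (∀ (i : Fin d) (j : Fin e), (j : ℕ) = i + 1 → β j ≤ α i)

/-! Write `β(S)` for the flag `h`-vector of `P` with a top added. Intervals below elements of `P`
are Boolean, so counting chains by their top element gives `β(S) = ∑ h_i D(n - i, S)`, where `D(k,
S)` counts permutations of `{0, …, n}` with descent set `S` and last value `k`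
(`IsGradedSimplicial.flagH_eq_sum`). Dualizing replaces `S` by `n + 1 - S`. Hence the Chow
polynomial `H` of the dual sums over isolated `S ⊆ {1, …, n - 1}` and the augmented one `G` over
isolated `S ⊆ {1, …, n}`, both with the same `β`; the second index set is invariant under
reflection, which gives the equality of augmented polynomials.

Put `y = z / (1 + z)^2`. Then `H(z) = (1 + z)^n q` and `G(z) = (1 + z)^(n + 1) p`, where `q` and `p`
are combinations, with weights `h_(n - k) ≥ 0`, of the descent generating functions `B_k` (isolated
`S`, `n ∉ S`) and `A_k = B_k + C_k` (all isolated `S`). Removing the last value of a permutation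
gives a recursion in `n` for `B` and `C`. Induction along it shows that suitable quotients of the
entries lie in the cone spanned by `1` and `y` (`LadderLevel.step`), whence `p * conj q = s + t y`
with `s > 0`, `t ≥ 0` (`IsLadder.sum_mul_conj`).

So `G * conj H = |1 + z|^(2n) (1 + z)(s + t z / (1 + z)^2)`, which has positive imaginary part when
`z` does (`im_one_add_mul_pos`). A Hermite–Biehler argument, following the argument of `G / H` down
vertical lines, turns this into real-rootedness and interlacing (`interlaces_of_im_pos`). -/

/-! ### Cone relations and ladders -/

/-- `g / f` lies in the convex cone spanned by `1` and `y` (suitably read when `f = 0`). -/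
def ConeRel (y f g : ℂ) : Prop :=
  ∃ s t : ℝ, 0 ≤ s ∧ 0 ≤ t ∧ g * (starRingEnd ℂ) f = s + t * y

namespace ConeRel

variable {y f f' g g' : ℂ}

theorem refl (y f : ℂ) : ConeRel y f f :=
  ⟨Complex.normSq f, 0, Complex.normSq_nonneg f, le_rfl, by simp [Complex.mul_conj]⟩

theorem zero_left (y g : ℂ) : ConeRel y 0 g := ⟨0, 0, le_rfl, le_rfl, by simp⟩

theorem zero_right (y f : ℂ) : ConeRel y f 0 := ⟨0, 0, le_rfl, le_rfl, by simp⟩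

theorem add_right (h : ConeRel y f g) (h' : ConeRel y f g') : ConeRel y f (g + g') := by
  obtain ⟨s, t, hs, ht, e⟩ := h
  obtain ⟨s', t', hs', ht', e'⟩ := h'
  exact ⟨s + s', t + t', by positivity, by positivity, by rw [add_mul, e, e']; push_cast; ring⟩

theorem add_left (h : ConeRel y f g) (h' : ConeRel y f' g) : ConeRel y (f + f') g := by
  obtain ⟨s, t, hs, ht, e⟩ := h
  obtain ⟨s', t', hs', ht', e'⟩ := h'
  exact ⟨s + s', t + t', by positivity, by positivity,
    by rw [map_add, mul_add, e, e']; push_cast; ring⟩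

theorem sum_right {ι : Type*} {s : Finset ι} {u : ι → ℂ} (h : ∀ i ∈ s, ConeRel y f (u i)) :
    ConeRel y f (∑ i ∈ s, u i) :=
  Finset.sum_induction u _ (fun _ _ => add_right) (zero_right y f) h

theorem sum_left {ι : Type*} {s : Finset ι} {u : ι → ℂ} (h : ∀ i ∈ s, ConeRel y (u i) g) :
    ConeRel y (∑ i ∈ s, u i) g :=
  Finset.sum_induction u (fun f => ConeRel y f g) (fun _ _ => add_left) (zero_left y g) h

theorem sum_sum {ι κ : Type*} {s : Finset ι} {s' : Finset κ} {u : ι → ℂ} {v : κ → ℂ}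
    (h : ∀ i ∈ s, ∀ j ∈ s', ConeRel y (u i) (v j)) :
    ConeRel y (∑ i ∈ s, u i) (∑ j ∈ s', v j) :=
  sum_left fun i hi => sum_right (h i hi)

theorem real_mul_right {c : ℝ} (hc : 0 ≤ c) (h : ConeRel y f g) : ConeRel y f (c * g) := by
  obtain ⟨s, t, hs, ht, e⟩ := h
  exact ⟨c * s, c * t, by positivity, by positivity, by rw [mul_assoc, e]; push_cast; ring⟩

theorem real_mul_left {c : ℝ} (hc : 0 ≤ c) (h : ConeRel y f g) : ConeRel y (c * f) g := by
  obtain ⟨s, t, hs, ht, e⟩ := h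
  refine ⟨c * s, c * t, by positivity, by positivity, ?_⟩
  rw [map_mul, Complex.conj_ofReal, mul_left_comm, e]; push_cast; ring

/-- Conjugating `g * conj f = s + t y` and multiplying by `y` gives `t |y|^2 + s y`. This is how the
factor `y` of the recursion for `C` is absorbed. -/
theorem rotate (h : ConeRel y f g) : ConeRel y g (y * f) := by
  obtain ⟨s, t, hs, ht, e⟩ := h
  refine ⟨t * Complex.normSq y, s, mul_nonneg ht (Complex.normSq_nonneg y), hs, ?_⟩
  have := congrArg (starRingEnd ℂ) e
  simp only [map_mul, map_add, Complex.conj_conj, Complex.conj_ofReal] at this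
  rw [mul_assoc, mul_comm f, this, Complex.ofReal_mul, Complex.normSq_eq_conj_mul_self]
  ring

theorem mul_mul (h : ConeRel y f g) : ConeRel y (y * f) (y * g) := h.rotate.rotate

/-- A point of the cone with positive real part `c` cannot vanish. -/
theorem cone_ne_zero (hy : ∀ r : ℝ, 0 < r → y ≠ -r) {s t : ℝ} (hs : 0 < s) (ht : 0 ≤ t) :
    (s : ℂ) + t * y ≠ 0 := by
  intro h
  rcases ht.eq_or_lt with rfl | ht
  · simp at h; exact hs.ne' h
  · refine hy (s / t) (by positivity) ?_
    have : (t : ℂ) ≠ 0 := by exact_mod_cast ht.ne'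
    push_cast
    field_simp
    linear_combination h

theorem add_ne_zero (hy : ∀ r : ℝ, 0 < r → y ≠ -r) (hf : f ≠ 0) (h : ConeRel y f g) :
    f + g ≠ 0 := by
  obtain ⟨s, t, hs, ht, e⟩ := h
  intro h0
  have hp : 0 < Complex.normSq f := Complex.normSq_pos.2 hf
  apply cone_ne_zero hy (s := Complex.normSq f + s) (t := t) (by positivity) ht
  have : (f + g) * (starRingEnd ℂ) f = 0 := by rw [h0, zero_mul]
  rw [add_mul, e, Complex.mul_conj] at this
  rw [← this]; push_cast; ring

end ConeRel

/-- The pair of triangular arrays with `B (N + 1) k = ∑ j < k, (B N j + C N j)` and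
`C (N + 1) k = y * ∑ k ≤ j ≤ N, B N j`. -/
structure IsLadder (y : ℂ) (B C : ℕ → ℕ → ℂ) : Prop where
  B_zero : B 0 0 = 1
  C_zero : C 0 0 = 0
  B_succ : ∀ N k, k ≤ N + 1 → B (N + 1) k = ∑ j ∈ Finset.range k, (B N j + C N j)
  C_succ : ∀ N k, k ≤ N + 1 → C (N + 1) k = y * ∑ j ∈ Finset.Ico k (N + 1), B N j

/-- The relations that hold between the entries of one level of a ladder. -/
structure LadderLevel (y : ℂ) (B C : ℕ → ℂ) (N : ℕ) : Prop where
  BB : ∀ k ≤ N, ∀ j ≤ k, ConeRel y (B k) (B j)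
  BC : ∀ k ≤ N, ∀ j ≤ N, ConeRel y (B k) (C j)
  AA : ∀ k ≤ N, ∀ j ≤ k, ConeRel y (B k + C k) (B j + C j)
  C_top : C N = 0
  B_top : B N ≠ 0

namespace LadderLevel

variable {y : ℂ} {B C B' C' : ℕ → ℂ} {N : ℕ}

theorem BA (h : LadderLevel y B C N) {k j : ℕ} (hk : k ≤ N) (hj : j ≤ k) :
    ConeRel y (B k) (B j + C j) :=
  (h.BB k hk j hj).add_right (h.BC k hk j (hj.trans hk))

/-- After `rotate`, this relates `B` to `C` on the next level. -/
theorem sum_B_sum_A (h : LadderLevel y B C N) {j k : ℕ} (hk : k ≤ N + 1) :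
    ConeRel y (∑ i ∈ Finset.Ico j (N + 1), B i) (∑ i ∈ Finset.range k, (B i + C i)) := by
  rcases le_total k j with hkj | hjk
  · refine ConeRel.sum_sum fun i hi l hl => ?_
    simp only [Finset.mem_Ico, Finset.mem_range] at hi hl
    exact h.BA (by omega) (by omega)
  · rw [Finset.sum_add_distrib]
    refine ConeRel.add_right ?_ (ConeRel.sum_sum fun i hi l hl => ?_)
    -- The ranges overlap in `[j, k)`. That common block is related to itself by `refl`; in all
    -- other pairs the left index is at least the right one, so `BB` applies.
    · rw [← Finset.sum_Ico_consecutive B hjk hk, Finset.range_eq_Ico,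
        ← Finset.sum_Ico_consecutive B (Nat.zero_le j) hjk]
      refine ConeRel.add_left (ConeRel.add_right ?_ (ConeRel.refl _ _))
        (ConeRel.add_right ?_ ?_) <;>
      · refine ConeRel.sum_sum fun i hi l hl => ?_
        simp only [Finset.mem_Ico] at hi hl
        exact h.BB _ (by omega) _ (by omega)
    · simp only [Finset.mem_Ico, Finset.mem_range] at hi hl
      exact h.BC _ (by omega) _ (by omega)

/-- The relation is additive in both arguments but not transitive in general, so each relation of
the new level is expanded into sums over the old one. A common part of the two sides is split off
and handled by `refl`. -/
theorem step (hy : ∀ r : ℝ, 0 < r → y ≠ -r) (h : LadderLevel y B C N)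
    (hB : ∀ k ≤ N + 1, B' k = ∑ j ∈ Finset.range k, (B j + C j))
    (hC : ∀ k ≤ N + 1, C' k = y * ∑ j ∈ Finset.Ico k (N + 1), B j) :
    LadderLevel y B' C' (N + 1) where
  BB k hk j hj := by
    rw [hB k hk, hB j (hj.trans hk), ← Finset.sum_range_add_sum_Ico _ hj]
    refine (ConeRel.refl _ _).add_left (ConeRel.sum_sum fun i hi l hl => ?_)
    simp only [Finset.mem_Ico, Finset.mem_range] at hi hl
    exact h.AA _ (by omega) _ (by omega)
  BC k hk j hj := by
    rw [hB k hk, hC j hj]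
    exact (h.sum_B_sum_A hk).rotate
  AA k hk l hl := by
    rw [hB k hk, hC k hk, hB l (hl.trans hk), hC l (hl.trans hk),
      ← Finset.sum_range_add_sum_Ico _ hl, ← Finset.sum_Ico_consecutive B hl hk]
    set Z := ∑ i ∈ Finset.range l, (B i + C i)
    set W := ∑ i ∈ Finset.Ico l k, (B i + C i) with hW
    set V := ∑ i ∈ Finset.Ico k (N + 1), B i
    set U := ∑ i ∈ Finset.Ico l k, B i
    have hZU : ConeRel y Z (y * U) := by
      refine ConeRel.rotate (ConeRel.sum_sum fun i hi l hl => ?_)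
      simp only [Finset.mem_Ico, Finset.mem_range] at hi hl
      exact h.BA (by omega) (by omega)
    have hVU : ConeRel y (y * V) (y * U) := by
      refine ConeRel.mul_mul (ConeRel.sum_sum fun i hi l hl => ?_)
      simp only [Finset.mem_Ico] at hi hl
      exact h.BB _ (by omega) _ (by omega)
    have hWZ : ConeRel y W Z := by
      refine ConeRel.sum_sum fun i hi l hl => ?_
      simp only [Finset.mem_Ico, Finset.mem_range] at hi hl
      exact h.AA _ (by omega) _ (by omega)
    have hWV : ConeRel y W (y * V) := by
      refine ConeRel.rotate (ConeRel.sum_sum fun i hi l hl => ?_)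
      simp only [Finset.mem_Ico] at hi hl
      exact h.BA (by omega) (by omega)
    have hWU : ConeRel y W (y * U) := by
      refine ConeRel.rotate ?_
      rw [hW, Finset.sum_add_distrib]
      refine (ConeRel.refl _ _).add_right (ConeRel.sum_sum fun i hi l hl => ?_)
      simp only [Finset.mem_Ico] at hi hl
      exact h.BC _ (by omega) _ (by omega)
    -- The common part is `Z + y V`; the remainders are `W` on the left and `y U` on the right, and
    -- all four resulting pairs are related.
    rw [show Z + W + y * V = (Z + y * V) + W by ring,
      show Z + y * (U + V) = (Z + y * V) + y * U by ring]
    exact ((ConeRel.refl _ _).add_right (hZU.add_left hVU)).add_left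
      ((hWZ.add_right hWV).add_right hWU)
  C_top := by simp [hC (N + 1) le_rfl]
  B_top := by
    rw [hB (N + 1) le_rfl, Finset.sum_range_succ, add_comm]
    have hN : B N + C N ≠ 0 := by simpa [h.C_top] using h.B_top
    refine ConeRel.add_ne_zero hy hN (ConeRel.sum_right fun i hi => ?_)
    exact h.AA _ le_rfl _ (Finset.mem_range.1 hi).le

end LadderLevel

theorem IsLadder.level {y : ℂ} {B C : ℕ → ℕ → ℂ} (h : IsLadder y B C)
    (hy : ∀ r : ℝ, 0 < r → y ≠ -r) (N : ℕ) : LadderLevel y (B N) (C N) N := by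
  induction N with
  | zero =>
    have hB := h.B_zero
    have hC := h.C_zero
    constructor <;> simp [hB, hC, ConeRel.refl, ConeRel.zero_right]
  | succ N ih => exact ih.step hy (h.B_succ N) (h.C_succ N)

/-- Nonnegative combinations of one level of a ladder: the quotient of the combination of the
`B + C` by that of the `B` lies in the open cone. -/
theorem IsLadder.sum_mul_conj {y : ℂ} {B C : ℕ → ℕ → ℂ} (h : IsLadder y B C)
    (hy : ∀ r : ℝ, 0 < r → y ≠ -r) (N : ℕ) (c : ℕ → ℝ) (hc : ∀ k ≤ N, 0 ≤ c k) (hN : 0 < c N) :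
    ∃ s t : ℝ, 0 < s ∧ 0 ≤ t ∧ (∑ k ∈ Finset.range (N + 1), c k * (B N k + C N k)) *
      (starRingEnd ℂ) (∑ k ∈ Finset.range (N + 1), c k * B N k) = s + t * y := by
  have L := h.level hy N
  set q := ∑ k ∈ Finset.range (N + 1), (c k : ℂ) * B N k with hq
  have hmem : ∀ {i}, i ∈ Finset.range (N + 1) → i ≤ N := fun hi =>
    Nat.lt_succ_iff.1 (Finset.mem_range.1 hi)
  have hq0 : q ≠ 0 := by
    rw [hq, Finset.sum_range_succ, add_comm]
    refine ConeRel.add_ne_zero hy (mul_ne_zero (by exact_mod_cast hN.ne') L.B_top)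
      (ConeRel.sum_right fun i hi => ?_)
    have hi' := (Finset.mem_range.1 hi).le
    exact ((L.BB N le_rfl i hi').real_mul_right (hc i hi')).real_mul_left hN.le
  have hrel : ConeRel y q (∑ k ∈ Finset.range (N + 1), (c k : ℂ) * C N k) :=
    ConeRel.sum_sum fun i hi j hj =>
      ((L.BC i (hmem hi) j (hmem hj)).real_mul_right (hc j (hmem hj))).real_mul_left
        (hc i (hmem hi))
  obtain ⟨s, t, hs, ht, e⟩ := hrel
  have hp : 0 < Complex.normSq q := Complex.normSq_pos.2 hq0
  refine ⟨Complex.normSq q + s, t, by positivity, ht, ?_⟩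
  simp_rw [mul_add]
  rw [Finset.sum_add_distrib, ← hq, add_mul, e, Complex.mul_conj]
  push_cast; ring

/-! ### Isolated sets -/

open Classical in
/-- The isolated subsets of `{a, …, b}`. -/
noncomputable def isolatedSets (a b : ℕ) : Finset (Finset ℕ) :=
  (Finset.Icc a b).powerset.filter IsIsolated

theorem mem_isolatedSets {a b : ℕ} {S : Finset ℕ} :
    S ∈ isolatedSets a b ↔ S ⊆ Finset.Icc a b ∧ IsIsolated S := by
  simp [isolatedSets]

/-- `S` and `S + 1` are disjoint subsets of `{a, …, b + 1}`. -/
theorem IsIsolated.two_mul_card_le {a b : ℕ} (hab : a ≤ b + 2) {S : Finset ℕ}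
    (hS : S ∈ isolatedSets a b) : 2 * S.card ≤ b + 2 - a := by
  obtain ⟨hS, hi⟩ := mem_isolatedSets.1 hS
  have hd : Disjoint S (S.image (· + 1)) := by
    rw [Finset.disjoint_left]
    intro x hx hx'
    obtain ⟨z, hz, rfl⟩ := Finset.mem_image.1 hx'
    exact hi z hz hx
  have hc : (S.image (· + 1)).card = S.card := Finset.card_image_of_injective _ fun a b h => by
    simpa using h
  have hsub : S ∪ S.image (· + 1) ⊆ Finset.Icc a (b + 1) := by
    intro x hx
    rcases Finset.mem_union.1 hx with hx | hx
    · have := Finset.mem_Icc.1 (hS hx)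
      exact Finset.mem_Icc.2 (by omega)
    · obtain ⟨z, hz, rfl⟩ := Finset.mem_image.1 hx
      have := Finset.mem_Icc.1 (hS hz)
      exact Finset.mem_Icc.2 (by omega)
  have := Finset.card_le_card hsub
  rw [Finset.card_union_of_disjoint hd, hc, Nat.card_Icc] at this
  omega

theorem empty_mem_isolatedSets (a b : ℕ) : ∅ ∈ isolatedSets a b :=
  mem_isolatedSets.2 ⟨by simp, fun i hi => by simp at hi⟩

theorem isolatedSets_one_zero : isolatedSets 1 0 = {∅} := by
  ext S
  simp only [mem_isolatedSets, Finset.mem_singleton]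
  constructor
  · rintro ⟨h, -⟩; simpa using h
  · rintro rfl; exact ⟨by simp, fun i hi => by simp at hi⟩

/-- Split the isolated subsets of `{1, …, N + 1}` according to whether they contain `N + 1`. -/
theorem sum_isolatedSets_succ {M : Type*} [AddCommMonoid M] (N : ℕ) (F : Finset ℕ → M) :
    ∑ S ∈ isolatedSets 1 (N + 1), F S =
      ∑ S ∈ isolatedSets 1 N, F S + ∑ S ∈ isolatedSets 1 (N - 1), F (insert (N + 1) S) := by
  classical
  rw [← Finset.sum_filter_add_sum_filter_not (isolatedSets 1 (N + 1)) (fun S => N + 1 ∉ S)]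
  congr 1
  · refine Finset.sum_congr ?_ fun _ _ => rfl
    ext S
    simp only [Finset.mem_filter, mem_isolatedSets]
    constructor
    · rintro ⟨⟨h, hi⟩, hN⟩
      refine ⟨fun x hx => ?_, hi⟩
      have := Finset.mem_Icc.1 (h hx)
      have : x ≠ N + 1 := fun e => hN (e ▸ hx)
      exact Finset.mem_Icc.2 (by omega)
    · rintro ⟨h, hi⟩
      refine ⟨⟨h.trans (Finset.Icc_subset_Icc_right (by omega)), hi⟩, fun hN => ?_⟩
      have := Finset.mem_Icc.1 (h hN)
      omega
  · symm
    refine Finset.sum_bij (fun S _ => insert (N + 1) S) ?_ ?_ ?_ fun _ _ => rfl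
    · intro S hS
      obtain ⟨h, hi⟩ := mem_isolatedSets.1 hS
      simp only [Finset.mem_filter, mem_isolatedSets, not_not]
      refine ⟨⟨fun x hx => ?_, fun i hx hx' => ?_⟩, Finset.mem_insert_self _ _⟩
      · rcases Finset.mem_insert.1 hx with rfl | hx
        · simp
        · have := Finset.mem_Icc.1 (h hx)
          exact Finset.mem_Icc.2 (by omega)
      · rcases Finset.mem_insert.1 hx with rfl | hx <;> rcases Finset.mem_insert.1 hx' with e | hx'
        · omega
        · have := Finset.mem_Icc.1 (h hx'); omega
        · have := Finset.mem_Icc.1 (h hx); omega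
        · exact hi i hx hx'
    · intro S hS S' hS' e
      have key : ∀ {U}, U ∈ isolatedSets 1 (N - 1) → N + 1 ∉ U := fun hU h => by
        have := Finset.mem_Icc.1 ((mem_isolatedSets.1 hU).1 h); omega
      rw [← Finset.erase_insert (key hS), ← Finset.erase_insert (key hS')]
      exact congrArg (Finset.erase · (N + 1)) e
    · intro S hS
      simp only [Finset.mem_filter, mem_isolatedSets, not_not] at hS
      obtain ⟨⟨h, hi⟩, hN⟩ := hS
      refine ⟨S.erase (N + 1), ?_, Finset.insert_erase hN⟩
      refine mem_isolatedSets.2 ⟨fun x hx => ?_, fun i hx hx' =>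
        hi i (Finset.mem_of_mem_erase hx) (Finset.mem_of_mem_erase hx')⟩
      have h1 := Finset.mem_Icc.1 (h (Finset.mem_of_mem_erase hx))
      have h2 := Finset.ne_of_mem_erase hx
      have h3 : x ≠ N := fun e => hi x (Finset.mem_of_mem_erase hx) (e ▸ hN)
      exact Finset.mem_Icc.2 (by omega)

/-! ### Permutations by descent set and last value -/

/-- For `k ≤ N` and `S ⊆ {1, …, N}`, the number of permutations of `{0, …, N}` with descent set `S`
whose last value is `k`, given by the recursion that removes the last value. -/
def descentCount : ℕ → ℕ → Finset ℕ → ℕ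
  | 0, _, _ => 1
  | N + 1, k, S =>
    if N + 1 ∈ S then ∑ j ∈ Finset.Ico k (N + 1), descentCount N j (S.erase (N + 1))
    else ∑ j ∈ Finset.range k, descentCount N j S

theorem descentCount_insert {N : ℕ} (k : ℕ) {S : Finset ℕ} (hS : N + 1 ∉ S) :
    descentCount (N + 1) k (insert (N + 1) S) = ∑ j ∈ Finset.Ico k (N + 1), descentCount N j S := by
  simp [descentCount, Finset.erase_insert hS]

theorem descentCount_of_notMem {N : ℕ} (k : ℕ) {S : Finset ℕ} (hS : N + 1 ∉ S) :
    descentCount (N + 1) k S = ∑ j ∈ Finset.range k, descentCount N j S := by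
  simp [descentCount, hS]

theorem sum_range_choose_left (r k : ℕ) :
    ∑ j ∈ Finset.range k, j.choose r = k.choose (r + 1) := by
  induction k with
  | zero => simp
  | succ k ih => rw [Finset.sum_range_succ, ih, Nat.choose_succ_succ, add_comm]

theorem descentCount_empty (N k : ℕ) : descentCount N k ∅ = k.choose N := by
  induction N generalizing k with
  | zero => simp [descentCount]
  | succ N ih => simp [descentCount, ih, sum_range_choose_left]

/-- The number of permutations with descent set contained in `T` and last value `k`. -/
def descentCountLE (N k : ℕ) (T : Finset ℕ) : ℕ := ∑ S ∈ T.powerset, descentCount N k S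

/-- The number of permutations of an `s`-element set with descent set contained in `T`. -/
def descentTotal (s : ℕ) (T : Finset ℕ) : ℕ := ∑ k ∈ Finset.range s, descentCountLE (s - 1) k T

theorem descentCountLE_of_notMem {N : ℕ} (k : ℕ) {T : Finset ℕ} (hT : N + 1 ∉ T) :
    descentCountLE (N + 1) k T = ∑ j ∈ Finset.range k, descentCountLE N j T := by
  simp only [descentCountLE]
  rw [Finset.sum_comm]
  exact Finset.sum_congr rfl fun S hS =>
    descentCount_of_notMem k fun h => hT (Finset.mem_powerset.1 hS h)

/-- With a descent allowed but not required before the last entry, the earlier entries are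
unconstrained by `k`. -/
theorem descentCountLE_insert {N k : ℕ} (hk : k ≤ N + 1) {T : Finset ℕ} (hT : N + 1 ∉ T) :
    descentCountLE (N + 1) k (insert (N + 1) T) = descentTotal (N + 1) T := by
  have hS : ∀ S ∈ T.powerset, N + 1 ∉ S := fun S hS h => hT (Finset.mem_powerset.1 hS h)
  simp only [descentCountLE, descentTotal, Nat.add_sub_cancel]
  rw [Finset.sum_powerset_insert hT, Finset.sum_comm, ← Finset.sum_add_distrib]
  refine Finset.sum_congr rfl fun S h => ?_
  rw [descentCount_of_notMem k (hS S h), descentCount_insert k (hS S h),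
    Finset.sum_range_add_sum_Ico _ hk]

/-- The last `r + 1` entries increase up to `k`: choose the other `r` among the `k` smaller values,
then arrange the first `t` entries freely subject to `T`. -/
theorem descentCountLE_insert_add {t : ℕ} (ht : 1 ≤ t) {T : Finset ℕ} (hT : ∀ i ∈ T, i < t)
    (r k : ℕ) (hk : k ≤ t + r) :
    descentCountLE (t + r) k (insert t T) = k.choose r * descentTotal t T := by
  obtain ⟨N, rfl⟩ : ∃ N, t = N + 1 := ⟨t - 1, by omega⟩
  induction r generalizing k with
  | zero => simpa using descentCountLE_insert (by simpa using hk) fun h => (hT _ h).false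
  | succ r ih =>
    rw [show N + 1 + (r + 1) = (N + 1 + r) + 1 by ring, descentCountLE_of_notMem,
      ← sum_range_choose_left, Finset.sum_mul]
    · refine Finset.sum_congr rfl fun j hj => ih j ?_
      have := Finset.mem_range.1 hj
      omega
    · intro h
      rcases Finset.mem_insert.1 h with h | h
      · omega
      · have := hT _ h; omega

theorem descentTotal_empty {s : ℕ} (hs : 1 ≤ s) : descentTotal s ∅ = 1 := by
  obtain ⟨N, rfl⟩ : ∃ N, s = N + 1 := ⟨s - 1, by omega⟩
  simp [descentTotal, descentCountLE, descentCount_empty, sum_range_choose_left]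

/-- This is also the recursion for flag numbers of a Boolean lattice of rank `s`, which is what
identifies the two counts. -/
theorem descentTotal_insert {s t : ℕ} (ht : 1 ≤ t) (hts : t < s) {T : Finset ℕ}
    (hT : ∀ i ∈ T, i < t) : descentTotal s (insert t T) = s.choose t * descentTotal t T := by
  obtain ⟨r, rfl⟩ : ∃ r, s = t + r + 1 := ⟨s - t - 1, by omega⟩
  have : (t + r + 1).choose t = (t + r + 1).choose (r + 1) :=
    Nat.choose_symm_of_eq_add (by ring)
  rw [this, ← sum_range_choose_left, Finset.sum_mul, descentTotal]
  refine Finset.sum_congr rfl fun k hk => ?_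
  have := Finset.mem_range.1 hk
  rw [Nat.add_sub_cancel]
  exact descentCountLE_insert_add ht hT r k (by omega)

/-- Möbius inversion on the Boolean lattice; it recovers exact descent sets from inclusions, as
`flagH` is obtained from `flagF`. -/
theorem sum_powerset_neg_one_pow_sdiff_mul_sum (b : Finset ℕ → ℤ) (S : Finset ℕ) :
    ∑ T ∈ S.powerset, (-1) ^ (S \ T).card * ∑ R ∈ T.powerset, b R = b S := by
  simp_rw [Finset.mul_sum]
  rw [Finset.sum_comm' (t' := S.powerset) (s' := fun R => Finset.Icc R S)]
  · rw [Finset.sum_eq_single S]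
    · simp
    · intro R hR hRS
      rw [← Finset.sum_mul]
      have hRS' := Finset.mem_powerset.1 hR
      have : ∑ T ∈ Finset.Icc R S, (-1 : ℤ) ^ (S \ T).card =
          ∑ U ∈ (S \ R).powerset, (-1 : ℤ) ^ U.card := by
        refine Finset.sum_bij' (fun T _ => S \ T) (fun U _ => S \ U) ?_ ?_ ?_ ?_ fun _ _ => rfl
        · intro T hT
          exact Finset.mem_powerset.2 (Finset.sdiff_subset_sdiff le_rfl (Finset.mem_Icc.1 hT).1)
        · intro U hU
          have hU' := Finset.mem_powerset.1 hU
          refine Finset.mem_Icc.2 ⟨fun x hx => Finset.mem_sdiff.2 ⟨hRS' hx, fun h => ?_⟩,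
            Finset.sdiff_subset⟩
          exact (Finset.mem_sdiff.1 (hU' h)).2 hx
        · intro T hT
          exact Finset.sdiff_sdiff_eq_self (Finset.mem_Icc.1 hT).2
        · intro U hU
          exact Finset.sdiff_sdiff_eq_self
            ((Finset.mem_powerset.1 hU).trans Finset.sdiff_subset)
      rw [this, Finset.sum_powerset_neg_one_pow_card_of_nonempty, zero_mul]
      rw [Finset.sdiff_nonempty]
      exact fun h => hRS (Finset.Subset.antisymm hRS' h)
    · simp
  · intro T R
    simp only [Finset.mem_powerset, Finset.mem_Icc]
    exact ⟨fun h => ⟨⟨h.2, h.1⟩, h.2.trans h.1⟩, fun h => ⟨h.1.2, h.1.1⟩⟩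

/-! ### Descent generating functions form a ladder -/

/-- The generating function, by number of descents, of the permutations of `{0, …, N}` with
isolated descent set contained in `{1, …, b}` and last value `k`. -/
noncomputable def isolatedDescentSum (b N k : ℕ) (y : ℂ) : ℂ :=
  ∑ S ∈ isolatedSets 1 b, (descentCount N k S : ℂ) * y ^ S.card

theorem isolatedDescentSum_pred_succ (N k : ℕ) (y : ℂ) :
    isolatedDescentSum N (N + 1) k y = ∑ j ∈ Finset.range k, isolatedDescentSum N N j y := by
  simp only [isolatedDescentSum]
  rw [Finset.sum_comm]
  refine Finset.sum_congr rfl fun S hS => ?_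
  rw [descentCount_of_notMem, Nat.cast_sum, Finset.sum_mul]
  intro h
  have := Finset.mem_Icc.1 ((mem_isolatedSets.1 hS).1 h)
  omega

/-- A descent at `N + 1` contributes a factor `y` and, by isolation, forbids one at `N`; hence the
bound `N - 1` in the second sum. -/
theorem isolatedDescentSum_succ (N k : ℕ) (y : ℂ) :
    isolatedDescentSum (N + 1) (N + 1) k y = isolatedDescentSum N (N + 1) k y +
      y * ∑ j ∈ Finset.Ico k (N + 1), isolatedDescentSum (N - 1) N j y := by
  simp only [isolatedDescentSum]
  rw [sum_isolatedSets_succ, Finset.sum_comm, Finset.mul_sum]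
  congr 1
  refine Finset.sum_congr rfl fun S hS => ?_
  have hS' : N + 1 ∉ S := fun h => by
    have := Finset.mem_Icc.1 ((mem_isolatedSets.1 hS).1 h); omega
  rw [descentCount_insert _ hS', Finset.card_insert_of_notMem hS', Nat.cast_sum, ← Finset.sum_mul]
  ring

theorem isLadder_isolatedDescentSum (y : ℂ) :
    IsLadder y (fun N k => isolatedDescentSum (N - 1) N k y)
      (fun N k => isolatedDescentSum N N k y - isolatedDescentSum (N - 1) N k y) where
  B_zero := by simp [isolatedDescentSum, isolatedSets_one_zero, descentCount]
  C_zero := by simp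
  B_succ N k _ := by simp [isolatedDescentSum_pred_succ]
  C_succ N k _ := by simp [isolatedDescentSum_succ]

theorem isolatedDescentSum_mul_conj {y : ℂ} (hy : ∀ r : ℝ, 0 < r → y ≠ -r) (N : ℕ) (c : ℕ → ℝ)
    (hc : ∀ k ≤ N, 0 ≤ c k) (hN : 0 < c N) :
    ∃ s t : ℝ, 0 < s ∧ 0 ≤ t ∧
      (∑ k ∈ Finset.range (N + 1), c k * isolatedDescentSum N N k y) *
      (starRingEnd ℂ) (∑ k ∈ Finset.range (N + 1), c k * isolatedDescentSum (N - 1) N k y) =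
        s + t * y := by
  simpa using (isLadder_isolatedDescentSum y).sum_mul_conj hy N c hc hN

/-! ### Hermite–Biehler: from the upper half plane to interlacing -/

/-- Polar form of a point of the upper half plane. -/
theorem Complex.add_I_eq_sqrt_mul_exp (u : ℝ) :
    (u : ℂ) + Complex.I = (√(1 + u ^ 2) : ℝ) *
      Complex.exp (((Real.pi / 2 - Real.arctan u : ℝ) : ℂ) * Complex.I) := by
  have h0 : √(1 + u ^ 2) ≠ 0 := (Real.sqrt_pos.2 (by positivity)).ne'
  rw [Complex.exp_mul_I, ← Complex.ofReal_cos, ← Complex.ofReal_sin, Real.cos_pi_div_two_sub,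
    Real.sin_pi_div_two_sub, Real.sin_arctan, Real.cos_arctan]
  apply Complex.ext
  · simp; field_simp
  · simp; field_simp

section Argument

variable {ι κ : Type*} [Fintype ι] [Fintype κ]

theorem prod_sub_eq_mul_exp (α : ι → ℝ) (t : ℝ) {s : ℝ} (hs : 0 < s) :
    ∃ R : ℝ, 0 < R ∧ ∏ i, (((t : ℂ) + (s⁻¹ : ℝ) * Complex.I) - α i) =
      R * Complex.exp (((∑ i, (Real.pi / 2 - Real.arctan ((t - α i) * s)) : ℝ) : ℂ) *
        Complex.I) := by
  refine ⟨∏ i, (s⁻¹ * √(1 + ((t - α i) * s) ^ 2)), Finset.prod_pos fun i _ => ?_, ?_⟩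
  · exact mul_pos (inv_pos.2 hs) (Real.sqrt_pos.2 (by positivity))
  · rw [Complex.ofReal_sum, Finset.sum_mul, Complex.exp_sum, Complex.ofReal_prod,
      ← Finset.prod_mul_distrib]
    refine Finset.prod_congr rfl fun i _ => ?_
    rw [Complex.ofReal_mul, mul_assoc, ← Complex.add_I_eq_sqrt_mul_exp]
    have : (s : ℂ) ≠ 0 := by exact_mod_cast hs.ne'
    push_cast
    field_simp
    ring

theorem tendsto_arg_summand {x t : ℝ} (h : x ≠ t) :
    Filter.Tendsto (fun s : ℝ => Real.pi / 2 - Real.arctan ((t - x) * s)) Filter.atTop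
      (nhds (if t < x then Real.pi else 0)) := by
  split_ifs with hx
  · have h1 : Filter.Tendsto (fun s : ℝ => (t - x) * s) Filter.atTop Filter.atBot :=
      Filter.tendsto_id.const_mul_atTop_of_neg (by linarith)
    have h2 := (Real.tendsto_arctan_atBot.mono_right nhdsWithin_le_nhds).comp h1
    have h3 := h2.const_sub (Real.pi / 2)
    rw [show Real.pi / 2 - -(Real.pi / 2) = Real.pi by ring] at h3
    exact h3
  · have h1 : Filter.Tendsto (fun s : ℝ => (t - x) * s) Filter.atTop Filter.atTop :=
      Filter.tendsto_id.const_mul_atTop (by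
        have := lt_of_le_of_ne (not_lt.1 hx) h
        linarith)
    have h2 := (Real.tendsto_arctan_atTop.mono_right nhdsWithin_le_nhds).comp h1
    have h3 := h2.const_sub (Real.pi / 2)
    rw [show Real.pi / 2 - Real.pi / 2 = (0 : ℝ) by ring] at h3
    exact h3

theorem card_filter_mul_pi (α : ι → ℝ) (t : ℝ) :
    ((Finset.univ.filter fun i => t < α i).card : ℝ) * Real.pi =
      ∑ i, if t < α i then Real.pi else 0 := by
  rw [← Finset.sum_filter, Finset.sum_const, nsmul_eq_mul]

/-- If the quotient of two monic real-rooted polynomials, whose degrees differ by one, maps the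
upper half plane to itself, then to the right of each point the numbers of roots differ by
zero or one. -/
theorem card_roots_right (hcard : Fintype.card κ = Fintype.card ι + 1) (α : ι → ℝ) (β : κ → ℝ)
    (him : ∀ z : ℂ, 0 < z.im →
      0 < ((∏ j, (z - β j)) * (starRingEnd ℂ) (∏ i, (z - α i))).im)
    (t : ℝ) (hα : ∀ i, α i ≠ t) (hβ : ∀ j, β j ≠ t) :
    (Finset.univ.filter fun i => t < α i).card ≤ (Finset.univ.filter fun j => t < β j).card ∧
    (Finset.univ.filter fun j => t < β j).card ≤
      (Finset.univ.filter fun i => t < α i).card + 1 := by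
  -- A continuous argument of the quotient at `t + i / s`. The value `s = 0` stands for the point at
  -- infinity, and `s → ∞` approaches the real point `t`.
  set Θ : ℝ → ℝ := fun s => ∑ j, (Real.pi / 2 - Real.arctan ((t - β j) * s)) -
    ∑ i, (Real.pi / 2 - Real.arctan ((t - α i) * s)) with hΘ
  have hcont : Continuous Θ := by
    refine Continuous.sub ?_ ?_ <;>
    exact continuous_finsetSum _ fun i _ =>
      continuous_const.sub (Real.continuous_arctan.comp (by fun_prop))
  -- Every summand is `π / 2` at `s = 0`, and there is exactly one more `β` than `α`.
  have hzero : Θ 0 = Real.pi / 2 := by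
    simp [hΘ, hcard]; ring
  have hsin : ∀ s, 0 < s → 0 < Real.sin (Θ s) := by
    intro s hs
    have h := him ((t : ℂ) + (s⁻¹ : ℝ) * Complex.I) (by simpa using hs)
    obtain ⟨R, hR, e⟩ := prod_sub_eq_mul_exp α t hs
    obtain ⟨R', hR', e'⟩ := prod_sub_eq_mul_exp β t hs
    rw [e, e', map_mul, Complex.conj_ofReal, ← Complex.exp_conj, map_mul, Complex.conj_I,
      Complex.conj_ofReal, mul_mul_mul_comm, ← Complex.exp_add, ← Complex.ofReal_mul,
      Complex.im_ofReal_mul] at h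
    rw [mul_neg, ← sub_eq_add_neg, ← sub_mul, ← Complex.ofReal_sub,
      Complex.exp_ofReal_mul_I_im] at h
    exact pos_of_mul_pos_right h (by positivity)
  have hpi := Real.pi_pos
  have hmem : ∀ s, 0 < s → 0 ≤ Θ s ∧ Θ s ≤ Real.pi := by
    -- By the intermediate value theorem, `Θ` cannot leave `[0, π]` without meeting a zero of the
    -- sine at a positive parameter.
    have key : ∀ v, Real.sin v = 0 → v ≠ Real.pi / 2 → ∀ s, 0 < s →
        v ∉ Set.uIcc (Θ 0) (Θ s) := by
      intro v hv hv' s hs hvs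
      obtain ⟨r, hr, e⟩ := intermediate_value_uIcc hcont.continuousOn hvs
      rw [Set.uIcc_of_le hs.le] at hr
      rcases hr.1.eq_or_lt with h0 | h0
      · exact hv' (by rw [← e, ← h0, hzero])
      · have := hsin r h0
        rw [e, hv] at this
        exact this.false
    intro s hs
    have h0 := key 0 Real.sin_zero (by positivity) s hs
    have h1 := key Real.pi Real.sin_pi (by linarith) s hs
    rw [hzero, Set.mem_uIcc] at h0 h1
    push Not at h0 h1
    constructor
    · by_contra h
      have := h0.2 (by linarith)
      linarith
    · by_contra h
      have := h1.1 (by linarith)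
      linarith
  have hlim : Filter.Tendsto Θ Filter.atTop
      (nhds (((Finset.univ.filter fun j => t < β j).card : ℝ) * Real.pi -
        ((Finset.univ.filter fun i => t < α i).card : ℝ) * Real.pi)) := by
    rw [card_filter_mul_pi α, card_filter_mul_pi β]
    exact (tendsto_finsetSum _ fun j _ => tendsto_arg_summand (hβ j)).sub
      (tendsto_finsetSum _ fun i _ => tendsto_arg_summand (hα i))
  have hge := ge_of_tendsto hlim (Filter.eventually_atTop.2 ⟨1, fun s hs =>
    (hmem s (by linarith)).1⟩)
  have hle := le_of_tendsto hlim (Filter.eventually_atTop.2 ⟨1, fun s hs =>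
    (hmem s (by linarith)).2⟩)
  rw [← sub_mul] at hge hle
  have h1 : (0 : ℝ) ≤ (Finset.univ.filter fun j => t < β j).card -
      (Finset.univ.filter fun i => t < α i).card := nonneg_of_mul_nonneg_left hge hpi
  have h2 : ((Finset.univ.filter fun j => t < β j).card : ℝ) -
      (Finset.univ.filter fun i => t < α i).card ≤ 1 := by
    by_contra h
    nlinarith
  constructor
  · have : ((Finset.univ.filter fun i => t < α i).card : ℝ) ≤
      (Finset.univ.filter fun j => t < β j).card := by linarith
    exact_mod_cast this
  · have : ((Finset.univ.filter fun j => t < β j).card : ℝ) ≤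
      (Finset.univ.filter fun i => t < α i).card + 1 := by linarith
    exact_mod_cast this

end Argument

theorem exists_between_ne {a b : ℝ} (hab : a < b) {ι κ : Type*} [Finite ι] [Finite κ]
    (α : ι → ℝ) (β : κ → ℝ) : ∃ t, a < t ∧ t < b ∧ (∀ i, α i ≠ t) ∧ ∀ j, β j ≠ t := by
  obtain ⟨t, ht, hn⟩ := (Set.Ioo_infinite hab).exists_notMem_finite
    ((Set.finite_range α).union (Set.finite_range β))
  refine ⟨t, ht.1, ht.2, fun i e => hn (Or.inl ⟨i, e⟩), fun j e => hn (Or.inr ⟨j, e⟩)⟩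

theorem card_filter_lt_ge {d : ℕ} {α : Fin d → ℝ} (hα : Antitone α) {t : ℝ} (i : Fin d)
    (h : t < α i) : (i : ℕ) + 1 ≤ (Finset.univ.filter fun i => t < α i).card := by
  rw [← Fin.card_Iic]
  exact Finset.card_le_card fun k hk =>
    Finset.mem_filter.2 ⟨Finset.mem_univ _, h.trans_le (hα (Finset.mem_Iic.1 hk))⟩

theorem card_filter_lt_le {d : ℕ} {α : Fin d → ℝ} (hα : Antitone α) {t : ℝ} (i : Fin d)
    (h : α i < t) : (Finset.univ.filter fun i => t < α i).card ≤ (i : ℕ) := by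
  rw [← Fin.card_Iio]
  refine Finset.card_le_card fun k hk => Finset.mem_Iio.2 ?_
  by_contra hki
  exact absurd (Finset.mem_filter.1 hk).2 (not_lt.2 ((hα (not_lt.1 hki)).trans h.le))

/-- A violated inequality leaves an open gap between two roots; at a point of it that is no root,
the counts of larger roots contradict `card_roots_right`. -/
theorem interlacing_of_im_pos {d e : ℕ} (hde : e = d + 1) {α : Fin d → ℝ} {β : Fin e → ℝ}
    (hα : Antitone α) (hβ : Antitone β)
    (him : ∀ z : ℂ, 0 < z.im →
      0 < ((∏ j, (z - β j)) * (starRingEnd ℂ) (∏ i, (z - α i))).im) :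
    (∀ (i : Fin d) (j : Fin e), (j : ℕ) = i → α i ≤ β j) ∧
    (∀ (i : Fin d) (j : Fin e), (j : ℕ) = i + 1 → β j ≤ α i) := by
  have key := card_roots_right (by simpa using hde) α β him
  constructor
  · intro i j hij
    by_contra! h
    obtain ⟨t, h1, h2, h3, h4⟩ := exists_between_ne h α β
    have := (key t h3 h4).1
    have := card_filter_lt_ge hα i h2
    have := card_filter_lt_le hβ j h1
    omega
  · intro i j hij
    by_contra! h
    obtain ⟨t, h1, h2, h3, h4⟩ := exists_between_ne h α β
    have := (key t h3 h4).2
    have := card_filter_lt_ge hβ j h2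
    have := card_filter_lt_le hα i h1
    omega

theorem isRealRooted_of_upper {f : ℝ[X]} (h : ∀ z : ℂ, 0 < z.im → aeval z f ≠ 0) :
    IsRealRooted f := by
  refine Or.inr fun z hz => ?_
  by_contra h0
  rcases lt_or_gt_of_ne h0 with h1 | h1
  · refine h ((starRingEnd ℂ) z) (by simpa using h1) ?_
    rw [Polynomial.aeval_conj, hz, map_zero]
  · exact h z h1 hz

/-- An irreducible real factor has a complex root, which is real by hypothesis, so the factor is
linear. -/
theorem IsRealRooted.splits {f : ℝ[X]} (h : IsRealRooted f) : f.Splits := by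
  rcases h with rfl | h
  · exact Splits.zero
  · rw [splits_iff_splits]
    refine Or.inr fun {g} hg hgf => ?_
    obtain ⟨z, hz⟩ := IsAlgClosed.exists_aeval_eq_zero ℂ g (by
      exact (degree_pos_of_irreducible hg).ne')
    have hz' : aeval z f = 0 := by
      obtain ⟨k, rfl⟩ := hgf
      rw [map_mul, hz, zero_mul]
    have hre : z = algebraMap ℝ ℂ z.re := Complex.ext (by simp) (by simpa using h z hz')
    rw [hre, aeval_algebraMap_apply, map_eq_zero] at hz
    exact degree_eq_one_of_irreducible_of_root hg hz

theorem IsRealRooted.exists_antitone_roots {f : ℝ[X]} (h : IsRealRooted f) (hf : f.Monic) :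
    ∃ α : Fin f.natDegree → ℝ, Antitone α ∧ f = ∏ i, (X - C (α i)) := by
  have hs := h.splits
  set l := f.roots.sort (· ≥ ·) with hl
  have hlen : l.length = f.natDegree := by
    rw [hl, Multiset.length_sort, hs.natDegree_eq_card_roots]
  have hprod : f = ∏ i : Fin l.length, (X - C (l.get i)) := by
    have h1 := hs.eq_prod_roots_of_monic hf
    have h2 : f.roots = (l : Multiset ℝ) := (Multiset.sort_eq _ _).symm
    rw [h2, Multiset.map_coe, Multiset.prod_coe] at h1
    conv_lhs => rw [h1]
    rw [← List.prod_ofFn, ← List.ofFn_get (l.map fun a => X - C a)]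
    simp [List.ofFn_eq_map]
  have hanti : Antitone l.get := (Multiset.pairwise_sort _ _).sortedGE.antitone_get
  rw [← hlen]
  exact ⟨l.get, hanti, hprod⟩

/-- Hermite–Biehler criterion for interlacing. -/
theorem interlaces_of_im_pos {f g : ℝ[X]} (hf : f.Monic) (hg : g.Monic)
    (hdeg : g.natDegree = f.natDegree + 1) (hf0 : ∀ i, 0 ≤ f.coeff i) (hg0 : ∀ i, 0 ≤ g.coeff i)
    (him : ∀ z : ℂ, 0 < z.im → 0 < (aeval z g * (starRingEnd ℂ) (aeval z f)).im) :
    IsRealRooted f ∧ Interlaces f g := by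
  have hfr : IsRealRooted f := isRealRooted_of_upper fun z hz h => by
    simpa [h] using him z hz
  have hgr : IsRealRooted g := isRealRooted_of_upper fun z hz h => by
    simpa [h] using him z hz
  obtain ⟨α, hα, ef⟩ := hfr.exists_antitone_roots hf
  obtain ⟨β, hβ, eg⟩ := hgr.exists_antitone_roots hg
  have haf : ∀ z : ℂ, aeval z f = ∏ i, (z - α i) := fun z => by
    conv_lhs => rw [ef]
    simp [map_prod]
  have hag : ∀ z : ℂ, aeval z g = ∏ j, (z - β j) := fun z => by
    conv_lhs => rw [eg]
    simp [map_prod]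
  have := interlacing_of_im_pos hdeg hα hβ fun z hz => by
    rw [← haf, ← hag]; exact him z hz
  refine ⟨hfr, hf.ne_zero, hg.ne_zero, hf0, hg0, _, _, α, β, hα, hβ, ?_, ?_, Or.inr hdeg,
    this.1, this.2⟩
  · rw [hf.leadingCoeff, C_1, one_mul, ← ef]
  · rw [hg.leadingCoeff, C_1, one_mul, ← eg]

/-! ### Rank functions, flag numbers and duality -/

/-- `r` is strictly monotone and takes all intermediate values between comparable elements. -/
structure IsRankFunction {Q : Type*} [PartialOrder Q] (r : Q → ℕ) : Prop where
  strictMono : StrictMono r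
  exists_between : ∀ ⦃x y : Q⦄, x < y → ∀ i, r x < i → i < r y → ∃ z, x < z ∧ z < y ∧ r z = i

namespace IsRankFunction

variable {Q : Type*} [PartialOrder Q] {r : Q → ℕ}

theorem height_eq [OrderBot Q] (h : IsRankFunction r) (h0 : r ⊥ = 0) (x : Q) :
    Order.height x = r x := by
  induction hN : r x using Nat.strong_induction_on generalizing x with
  | _ N ih =>
    apply le_antisymm
    · rw [Order.height_le_coe_iff]
      intro y hy
      have := h.strictMono hy
      rw [ih (r y) (by omega) y rfl]
      exact_mod_cast (by omega : r y < N)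
    · rcases N with _ | k
      · simp
      · obtain ⟨z, hz, hk⟩ : ∃ z, z < x ∧ r z = k := by
          have hx : ⊥ < x := bot_lt_iff_ne_bot.2 fun e => by rw [e, h0] at hN; omega
          rcases k with _ | k
          · exact ⟨⊥, hx, h0⟩
          · obtain ⟨z, -, hz, hk⟩ := h.exists_between hx (k + 1) (by omega) (by omega)
            exact ⟨z, hz, hk⟩
        have := Order.height_add_one_le hz
        rw [ih k (by omega) z hk] at this
        exact_mod_cast this

theorem dual (h : IsRankFunction r) {N : ℕ} (hN : ∀ x, r x ≤ N) :
    IsRankFunction fun x : Qᵒᵈ => N - r (OrderDual.ofDual x) where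
  strictMono x y hxy := by
    have h1 := h.strictMono (OrderDual.ofDual_lt_ofDual.2 hxy)
    have h2 := hN (OrderDual.ofDual x)
    change N - r (OrderDual.ofDual x) < N - r (OrderDual.ofDual y)
    omega
  exists_between x y hxy i hi hi' := by
    have h1 := hN (OrderDual.ofDual x)
    have h2 := hN (OrderDual.ofDual y)
    obtain ⟨z, hz, hz', e⟩ := h.exists_between (OrderDual.ofDual_lt_ofDual.2 hxy) (N - i)
      (by omega) (by omega)
    exact ⟨OrderDual.toDual z, hz', hz, by simp only [OrderDual.ofDual_toDual]; omega⟩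

theorem eq_of_isChain (h : IsRankFunction r) {c : Set Q} (hc : IsChain (· ≤ ·) c) {x y : Q}
    (hx : x ∈ c) (hy : y ∈ c) (hxy : r x = r y) : x = y := by
  by_contra hne
  rcases hc hx hy hne with hle | hle
  · exact (h.strictMono (lt_of_le_of_ne hle hne)).ne hxy
  · exact (h.strictMono (lt_of_le_of_ne hle (Ne.symm hne))).ne' hxy

theorem lt_of_isChain (h : IsRankFunction r) {c : Set Q} (hc : IsChain (· ≤ ·) c) {x y : Q}
    (hx : x ∈ c) (hy : y ∈ c) (hxy : r x < r y) : x < y := by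
  have hne : x ≠ y := fun e => by simp [e] at hxy
  rcases hc hx hy hne with hle | hle
  · exact lt_of_le_of_ne hle hne
  · exact absurd (h.strictMono (lt_of_le_of_ne hle (Ne.symm hne))) (by omega)

/-- A chain that misses a rank can be extended by an element of this rank. -/
theorem exists_isChain_insert [BoundedOrder Q] [Finite Q] (h : IsRankFunction r) {c : Set Q}
    (hc : IsChain (· ≤ ·) c) {i : ℕ} (h0 : r ⊥ < i) (h1 : i < r ⊤) (hi : ∀ x ∈ c, r x ≠ i) :
    ∃ z, r z = i ∧ IsChain (· ≤ ·) (insert z c) := by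
  have hc' : IsChain (· ≤ ·) (insert ⊤ (insert ⊥ c)) :=
    (hc.insert fun b _ _ => Or.inl bot_le).insert fun b _ _ => Or.inr le_top
  have hi' : ∀ x ∈ insert ⊤ (insert ⊥ c), r x ≠ i := by
    rintro x (rfl | rfl | hx)
    · exact h1.ne'
    · exact h0.ne
    · exact hi x hx
  -- The new element goes between the neighbours of rank `i` in the chain; adjoining `⊥` and `⊤`
  -- ensures that both exist.
  obtain ⟨x, ⟨hxc, hxi⟩, hx⟩ := Set.exists_max_image {w ∈ insert ⊤ (insert ⊥ c) | r w < i} r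
    (Set.toFinite _) ⟨⊥, Or.inr (Or.inl rfl), h0⟩
  obtain ⟨y, ⟨hyc, hyi⟩, hy⟩ := Set.exists_min_image {w ∈ insert ⊤ (insert ⊥ c) | i < r w} r
    (Set.toFinite _) ⟨⊤, Or.inl rfl, h1⟩
  obtain ⟨z, hxz, hzy, hz⟩ := h.exists_between (h.lt_of_isChain hc' hxc hyc (hxi.trans hyi)) i
    hxi hyi
  refine ⟨z, hz, hc.insert fun w hw _ => ?_⟩
  have hwc : w ∈ insert ⊤ (insert ⊥ c) := Or.inr (Or.inr hw)
  rcases lt_or_gt_of_ne (hi w hw) with hwi | hwi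
  · refine Or.inr (le_trans ?_ hxz.le)
    rcases (hx w ⟨hwc, hwi⟩).eq_or_lt with e | e
    · exact (h.eq_of_isChain hc' hwc hxc e).le
    · exact (h.lt_of_isChain hc' hwc hxc e).le
  · refine Or.inl (hzy.le.trans ?_)
    rcases (hy w ⟨hwc, hwi⟩).eq_or_lt with e | e
    · exact (h.eq_of_isChain hc' hyc hwc e).le
    · exact (h.lt_of_isChain hc' hyc hwc e).le

theorem isChain_val_image {T : Finset ℕ} {s : Set (RankSelected Q T)}
    (hs : IsChain (· ≤ ·) s) : IsChain (· ≤ ·) (Subtype.val '' s) := by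
  rintro _ ⟨x, hx, rfl⟩ _ ⟨y, hy, rfl⟩ hxy
  exact hs hx hy fun e => hxy (by rw [e])

/-- The maximal chains of a rank-selected subposet are the chains with the given set of ranks. -/
theorem flagF_eq [BoundedOrder Q] [Finite Q] (h : IsRankFunction r) (h0 : r ⊥ = 0) {T : Finset ℕ}
    (hT : ∀ i ∈ T, 0 < i ∧ i < r ⊤) :
    flagF Q T = Nat.card {c : Set Q // IsChain (· ≤ ·) c ∧ r '' c = T} := by
  have hh := h.height_eq h0
  have hrank : ∀ x : RankSelected Q T, r x.1 ∈ T := by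
    rintro ⟨x, i, hi, e⟩
    rw [hh x] at e
    have : r x = i := by exact_mod_cast e
    simpa [this] using hi
  refine Nat.card_congr ?_
  refine
    { toFun := fun s => ⟨Subtype.val '' (s : Set (RankSelected Q T)),
        isChain_val_image s.Chain', ?_⟩
      invFun := fun c => ⟨Subtype.val ⁻¹' c.1, ?_, ?_⟩
      left_inv := fun s => ?_
      right_inv := fun c => ?_ }
  · apply Set.Subset.antisymm
    · rintro _ ⟨_, ⟨x, -, rfl⟩, rfl⟩
      exact hrank x
    · intro i hi
      by_contra hni
      obtain ⟨z, hz, hzc⟩ := h.exists_isChain_insert (isChain_val_image s.Chain')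
        (i := i) (by rw [h0]; exact (hT i hi).1) (hT i hi).2
        (fun x hx e => hni ⟨x, hx, e⟩)
      let z' : RankSelected Q T := ⟨z, i, hi, by rw [hh z, hz]⟩
      have hch : IsChain (· ≤ ·) (insert z' s.carrier) := by
        intro x hx y hy hxy
        refine hzc ?_ ?_ fun e => hxy (Subtype.ext e)
        · rcases hx with rfl | hx
          · exact Or.inl rfl
          · exact Or.inr ⟨x, hx, rfl⟩
        · rcases hy with rfl | hy
          · exact Or.inl rfl
          · exact Or.inr ⟨y, hy, rfl⟩
      have := s.max_chain' hch (Set.subset_insert _ _)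
      have hz' : z' ∈ s.carrier := by rw [this]; exact Set.mem_insert _ _
      exact hni ⟨z, ⟨z', hz', rfl⟩, hz⟩
  · intro x hx y hy hxy
    exact c.2.1 hx hy fun e => hxy (Subtype.ext e)
  · intro t ht hct
    refine hct.antisymm fun x hx => ?_
    have hxT : r x.1 ∈ r '' c.1 := by rw [c.2.2]; exact hrank x
    obtain ⟨w, hw, hwx⟩ := hxT
    let w' : RankSelected Q T := ⟨w, r w, by
      have : r w ∈ r '' c.1 := ⟨w, hw, rfl⟩
      rw [c.2.2] at this; exact this, hh w⟩
    have hwt : w' ∈ t := hct hw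
    have : w = x.1 := h.eq_of_isChain (isChain_val_image ht) ⟨w', hwt, rfl⟩ ⟨x, hx, rfl⟩ hwx
    change x.1 ∈ c.1
    rw [← this]; exact hw
  · apply Flag.ext
    exact Set.preimage_image_eq _ Subtype.val_injective
  · apply Subtype.ext
    refine Set.image_preimage_eq_of_subset fun x hx => ?_
    have : r x ∈ r '' c.1 := ⟨x, hx, rfl⟩
    rw [c.2.2] at this
    exact ⟨⟨x, r x, this, hh x⟩, rfl⟩

theorem flagF_dual [BoundedOrder Q] [Finite Q] (h : IsRankFunction r) (h0 : r ⊥ = 0) {N : ℕ}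
    (hN : r ⊤ = N) {T : Finset ℕ} (hT : ∀ i ∈ T, 0 < i ∧ i < N) :
    flagF Qᵒᵈ T = flagF Q (T.image (N - ·)) := by
  have hle : ∀ x, r x ≤ N := fun x => hN ▸ h.strictMono.monotone le_top
  have hT' : ∀ i ∈ T.image (N - ·), 0 < i ∧ i < r ⊤ := by
    intro i hi
    obtain ⟨j, hj, rfl⟩ := Finset.mem_image.1 hi
    have := hT j hj
    constructor <;> omega
  rw [h.flagF_eq h0 hT', (h.dual hle).flagF_eq (by simp [hN]) (T := T) (by simpa [h0] using hT)]
  refine Nat.card_congr (Equiv.subtypeEquiv (Equiv.refl _) fun c => and_congr ?_ ?_)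
  · exact ⟨fun hc => hc.symm, fun hc => hc.symm⟩
  · simp only [Finset.coe_image]
    constructor
    · intro e
      rw [← e, Set.image_image]
      refine Set.image_congr fun x _ => ?_
      have := hle x
      change r x = N - (N - r x)
      omega
    · intro e
      have : (fun x : Qᵒᵈ => N - r (OrderDual.ofDual x)) '' c = (N - ·) '' (r '' c) :=
        (Set.image_image _ _ _).symm
      refine this.trans ((congrArg ((N - ·) '' ·) e).trans ?_)
      simp only [Set.image_image]
      apply Set.Subset.antisymm
      · rintro _ ⟨i, hi, rfl⟩
        have := hT i hi
        have hi' : N - (N - i) = i := by omega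
        change N - (N - i) ∈ _
        rwa [hi']
      · intro i hi
        have := hT i hi
        exact ⟨i, hi, Nat.sub_sub_self (by omega)⟩

theorem flagH_dual [BoundedOrder Q] [Finite Q] (h : IsRankFunction r) (h0 : r ⊥ = 0) {N : ℕ}
    (hN : r ⊤ = N) {S : Finset ℕ} (hS : ∀ i ∈ S, 0 < i ∧ i < N) :
    flagH Qᵒᵈ S = flagH Q (S.image (N - ·)) := by
  have hinj : Set.InjOn (N - ·) (S : Set ℕ) := by
    intro a ha b hb e
    have := hS a ha
    have := hS b hb
    dsimp only at e
    omega
  refine Finset.sum_bij (fun T _ => T.image (N - ·)) ?_ ?_ ?_ ?_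
  · intro T hT
    exact Finset.mem_powerset.2 (Finset.image_subset_image (Finset.mem_powerset.1 hT))
  · intro T hT T' hT' e
    have e' := congrArg (fun U : Finset ℕ => (U : Set ℕ)) e
    simp only [Finset.coe_image] at e'
    exact_mod_cast (hinj.image_eq_image_iff (by exact_mod_cast Finset.mem_powerset.1 hT)
      (by exact_mod_cast Finset.mem_powerset.1 hT')).1 e'
  · intro U hU
    obtain ⟨T, hT, e⟩ := Finset.subset_image_iff.1 (Finset.mem_powerset.1 hU)
    exact ⟨T, Finset.mem_powerset.2 (by exact_mod_cast hT), e⟩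
  · intro T hT
    have hTS := Finset.mem_powerset.1 hT
    rw [h.flagF_dual h0 hN fun i hi => hS i (hTS hi),
      Finset.card_sdiff_of_subset hTS,
      Finset.card_sdiff_of_subset (Finset.image_subset_image hTS),
      Finset.card_image_of_injOn hinj, Finset.card_image_of_injOn (hinj.mono (by exact_mod_cast hTS))]

end IsRankFunction

/-- The number of chains with rank set `T` all of whose elements are less than `x`. -/
noncomputable def chainCount {Q : Type*} [PartialOrder Q] (r : Q → ℕ) (x : Q) (T : Finset ℕ) : ℕ :=
  Nat.card {c : Set Q // IsChain (· ≤ ·) c ∧ r '' c = T ∧ ∀ y ∈ c, y < x}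

namespace IsRankFunction

variable {Q : Type*} [PartialOrder Q] {r : Q → ℕ}

theorem chainCount_empty (r : Q → ℕ) (x : Q) : chainCount r x ∅ = 1 := by
  rw [chainCount, Nat.card_eq_one_iff_unique]
  refine ⟨⟨fun a b => Subtype.ext ?_⟩, ⟨⟨∅, by simp [IsChain]⟩⟩⟩
  have ha := a.2.2.1
  have hb := b.2.2.1
  simp only [Finset.coe_empty, Set.image_eq_empty] at ha hb
  rw [ha, hb]

/-- Chains are fibred over their unique element of rank `t`, which is their largest. -/
theorem chainCount_insert [Finite Q] (h : IsRankFunction r) (x : Q) {t : ℕ} {T : Finset ℕ}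
    (hT : ∀ i ∈ T, i < t) {K : ℕ} (hK : ∀ z, z < x → r z = t → chainCount r z T = K) :
    chainCount r x (insert t T) = Nat.card {z : Q // z < x ∧ r z = t} * K := by
  classical
  have : Fintype Q := Fintype.ofFinite Q
  have hsum : ∑ z : {z : Q // z < x ∧ r z = t}, chainCount r z.1 T =
      Nat.card {z : Q // z < x ∧ r z = t} * K := by
    rw [Finset.sum_congr rfl fun z _ => hK z.1 z.2.1 z.2.2]
    simp
  rw [← hsum]
  simp only [chainCount]
  rw [← Nat.card_sigma]
  symm
  have hrT : ∀ {z : Q} {c : Set Q}, r '' c = T → r z = t → z ∉ c := by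
    intro z c hc hz hzc
    have : r z ∈ r '' c := ⟨z, hzc, rfl⟩
    rw [hc] at this
    exact (hT _ this).ne hz
  refine Nat.card_eq_of_bijective (fun p : (z : {z : Q // z < x ∧ r z = t}) ×
    {c : Set Q // IsChain (· ≤ ·) c ∧ r '' c = T ∧ ∀ y ∈ c, y < z.1} =>
      (⟨insert p.1.1 p.2.1, p.2.2.1.insert fun b hb _ => Or.inr (p.2.2.2.2 b hb).le, by
        rw [Set.image_insert_eq, p.2.2.2.1, p.1.2.2, Finset.coe_insert], by
        rintro y (rfl | hy)
        · exact p.1.2.1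
        · exact (p.2.2.2.2 y hy).trans p.1.2.1⟩ :
        {c : Set Q // IsChain (· ≤ ·) c ∧ r '' c = ↑(insert t T) ∧ ∀ y ∈ c, y < x})) ⟨?_, ?_⟩
  · rintro ⟨⟨z, hz, hzt⟩, ⟨c, hc, hcT, hcz⟩⟩ ⟨⟨z', hz', hzt'⟩, ⟨c', hc', hcT', hcz'⟩⟩ e
    have e : insert z c = insert z' c' := congrArg Subtype.val e
    have hzz : z = z' := by
      have : z ∈ insert z' c' := e ▸ Set.mem_insert z c
      rcases this with h1 | h1
      · exact h1
      · exact absurd h1 (hrT hcT' hzt)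
    subst hzz
    have hcc : c = c' := by
      have h1 := hrT hcT hzt
      have h2 := hrT hcT' hzt
      rw [← Set.insert_sdiff_self_of_notMem h1, e, Set.insert_sdiff_self_of_notMem h2]
    subst hcc
    rfl
  · rintro ⟨d, hd, hdT, hdx⟩
    obtain ⟨z, hz, hzt⟩ : t ∈ r '' d := by rw [hdT]; simp
    have hmem : ∀ w ∈ d, w ≠ z → r w ∈ T := by
      intro w hw hwz
      have : r w ∈ r '' d := ⟨w, hw, rfl⟩
      rw [hdT, Finset.coe_insert] at this
      rcases this with h1 | h1
      · exact absurd (h.eq_of_isChain hd hw hz (h1.trans hzt.symm)) hwz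
      · exact h1
    refine ⟨⟨⟨z, hdx z hz, hzt⟩, ⟨d \ {z}, hd.mono Set.sdiff_subset, ?_, ?_⟩⟩, ?_⟩
    · apply Set.Subset.antisymm
      · rintro _ ⟨w, ⟨hw, hwz⟩, rfl⟩
        exact hmem w hw hwz
      · intro i hi
        have : i ∈ r '' d := by rw [hdT, Finset.coe_insert]; exact Or.inr hi
        obtain ⟨w, hw, rfl⟩ := this
        refine ⟨w, ⟨hw, fun e => ?_⟩, rfl⟩
        have := hT _ hi
        rw [e, hzt] at this
        exact this.false
    · rintro w ⟨hw, hwz⟩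
      refine h.lt_of_isChain hd hw hz ?_
      rw [hzt]
      exact hT _ (hmem w hw hwz)
    · apply Subtype.ext
      simp [Set.insert_eq_of_mem hz]

end IsRankFunction

/-! ### Face numbers from the `h`-vector -/

theorem numOfRank_eq_sum_hVector (P : Type*) [PartialOrder P] (n : ℕ) {t : ℕ} (ht : t ≤ n) :
    (numOfRank P t : ℤ) =
      ∑ i ∈ Finset.range (n + 1), hVector P n i * ((n - i).choose (n - t) : ℤ) := by
  have hdeg : (hPolynomial P n).natDegree < n + 1 := by
    rw [Nat.lt_succ_iff, hPolynomial]
    refine natDegree_sum_le_of_forall_le _ _ fun i hi => ?_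
    have hi' := Finset.mem_range.1 hi
    have h1 : (1 - X : ℤ[X]).natDegree ≤ 1 := by
      refine (natDegree_sub_le _ _).trans ?_
      simp
    calc _ ≤ (0 + i) + (n - i) * 1 := by
          refine natDegree_mul_le_of_le (natDegree_mul_le_of_le ?_ ?_) (natDegree_pow_le_of_le _ h1)
          · exact (natDegree_natCast _).le
          · exact natDegree_X_pow_le i
      _ ≤ n := by omega
  have hexp : hPolynomial P n = ∑ i ∈ Finset.range (n + 1), monomial i (hVector P n i) :=
    (hPolynomial P n).as_sum_range' (n + 1) hdeg
  set F : ℤ[X] := ∑ i ∈ Finset.range (n + 1), C (numOfRank P i : ℤ) * X ^ i with hF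
  set H : ℤ[X] := ∑ i ∈ Finset.range (n + 1), C (hVector P n i) * (X ^ i * (1 + X) ^ (n - i)) with hH
  have heq : F.map (Int.castRingHom ℚ) = H.map (Int.castRingHom ℚ) := by
    -- The substitution `x = z / (1 + z)`, after multiplication by `(1 + z)^n`, turns the definition
    -- of the `h`-polynomial into `∑ f_(i-1) z^i = ∑ h_i z^i (1 + z)^(n - i)`; positive rationals
    -- avoid the pole.
    refine eq_of_infinite_eval_eq _ _ ((Set.Ioi_infinite (0 : ℚ)).mono fun z hz => ?_)
    have hz : (0 : ℚ) < z := hz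
    have h1z : 1 + z ≠ 0 := by positivity
    have hw : 1 - z / (1 + z) = 1 / (1 + z) := by field_simp; ring
    have key := congrArg (fun p : ℤ[X] => (p.map (Int.castRingHom ℚ)).eval (z / (1 + z))) hexp
    simp only [hPolynomial, Polynomial.map_sum, eval_finsetSum] at key
    have hl : ∀ i ∈ Finset.range (n + 1), z ^ i = (1 + z) ^ n *
        ((z / (1 + z)) ^ i * (1 / (1 + z)) ^ (n - i)) := by
      intro i hi
      have hi' := Finset.mem_range.1 hi
      rw [show (1 + z) ^ n = (1 + z) ^ i * (1 + z) ^ (n - i) by rw [← pow_add]; congr 1; omega]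
      simp only [div_pow, one_pow]
      field_simp
    have hr : ∀ i ∈ Finset.range (n + 1), z ^ i * (1 + z) ^ (n - i) = (1 + z) ^ n *
        (z / (1 + z)) ^ i := by
      intro i hi
      have hi' := Finset.mem_range.1 hi
      rw [show (1 + z) ^ n = (1 + z) ^ i * (1 + z) ^ (n - i) by rw [← pow_add]; congr 1; omega]
      simp only [div_pow]
      field_simp
    change (F.map (Int.castRingHom ℚ)).eval z = (H.map (Int.castRingHom ℚ)).eval z
    simp only [hF, hH, Polynomial.map_sum, eval_finsetSum, Polynomial.map_mul, Polynomial.map_pow,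
      Polynomial.map_add, Polynomial.map_one, Polynomial.map_X, Polynomial.map_C, eval_mul,
      eval_pow, eval_C, eval_X, eval_add, eval_one, Polynomial.map_natCast, eval_natCast,
      Polynomial.map_sub, eval_sub, hw, Polynomial.map_monomial, eval_monomial] at key ⊢
    rw [← mul_right_inj' (pow_ne_zero n h1z), Finset.mul_sum, Finset.mul_sum] at key
    refine Eq.trans (Finset.sum_congr rfl fun i hi => ?_)
      (key.trans (Finset.sum_congr rfl fun i hi => ?_))
    · rw [hl i hi]; simp; ring
    · rw [hr i hi]; ring
  have heq' : F = H := map_injective _ (RingHom.injective_int _) heq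
  have hc := congrArg (fun p : ℤ[X] => p.coeff t) heq'
  simp only [hF, hH, finsetSum_coeff, coeff_C_mul, coeff_X_pow, coeff_X_pow_mul'] at hc
  rw [Finset.sum_eq_single t (fun b _ hb => by simp [Ne.symm hb])
    (fun h => absurd (Finset.mem_range.2 (by omega)) h)] at hc
  simp only [if_true, mul_one] at hc
  rw [hc]
  refine Finset.sum_congr rfl fun i hi => ?_
  have hi' := Finset.mem_range.1 hi
  congr 1
  split_ifs with hit
  · rw [coeff_one_add_X_pow]
    norm_cast
    rw [← Nat.choose_symm (by omega)]
    congr 1; omega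
  · rw [Nat.choose_eq_zero_of_lt (by omega)]; rfl

theorem numOfRank_zero (P : Type*) [PartialOrder P] [OrderBot P] : numOfRank P 0 = 1 := by
  rw [numOfRank, Nat.card_eq_one_iff_unique]
  refine ⟨⟨fun a b => Subtype.ext ?_⟩, ⟨⟨⊥, by simp⟩⟩⟩
  have ha := a.2
  have hb := b.2
  simp only [Nat.cast_zero, Order.height_eq_zero, isMin_iff_eq_bot] at ha hb
  rw [ha, hb]

theorem hVector_zero (P : Type*) [PartialOrder P] [OrderBot P] (n : ℕ) : hVector P n 0 = 1 := by
  have := numOfRank_eq_sum_hVector P n (Nat.zero_le n)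
  rw [numOfRank_zero, Finset.sum_eq_single 0] at this
  · simpa using this.symm
  · intro i hi hi0
    have := Finset.mem_range.1 hi
    rw [Nat.choose_eq_zero_of_lt (by omega)]; simp
  · simp

/-! ### Flag vectors of simplicial posets -/

section Simplicial

variable {P : Type*} [PartialOrder P] {n : ℕ}

/-- The rank function of a graded simplicial poset of rank `n` with a top element added. -/
noncomputable def withTopRank (P : Type*) [PartialOrder P] (n : ℕ) : WithTop P → ℕ :=
  WithTop.recTopCoe (n + 1) fun p => (Order.height p).toNat

@[simp] theorem withTopRank_top : withTopRank P n ⊤ = n + 1 := rfl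

theorem withTopRank_coe (p : P) : withTopRank P n p = (Order.height p).toNat := rfl

variable [OrderBot P]

theorem height_eq_card_chart {m : P} (e : Set.Icc ⊥ m ≃o Finset (Fin n)) {x : P} (hx : x ≤ m) :
    Order.height x = (e ⟨x, bot_le, hx⟩).card := by
  induction hN : (e ⟨x, bot_le, hx⟩).card using Nat.strong_induction_on generalizing x with
  | _ N ih =>
    apply le_antisymm
    · rw [Order.height_le_coe_iff]
      intro y hy
      have hlt : e ⟨y, bot_le, hy.le.trans hx⟩ < e ⟨x, bot_le, hx⟩ := e.lt_iff_lt.2 hy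
      have hc := hN ▸ Finset.card_lt_card hlt
      rw [ih _ hc (hy.le.trans hx) rfl]
      exact_mod_cast hc
    · rcases N with _ | k
      · simp
      · obtain ⟨u, hu, hk⟩ := Finset.exists_subset_card_eq (n := k)
          (s := e ⟨x, bot_le, hx⟩) (by omega)
        have hlt : e.symm u < ⟨x, bot_le, hx⟩ := by
          rw [← e.lt_iff_lt, e.apply_symm_apply]
          exact Finset.ssubset_iff_subset_ne.2 ⟨hu, fun h => by rw [h, hN] at hk; omega⟩
        have hz := ih k (by omega) (e.symm u).2.2 (by
          change (e (e.symm u)).card = k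
          rw [e.apply_symm_apply, hk])
        have := Order.height_add_one_le (show (e.symm u).1 < x from hlt)
        rw [hz] at this
        exact_mod_cast this

theorem withTopRank_bot : withTopRank P n ⊥ = 0 := by
  rw [← WithTop.coe_bot, withTopRank_coe]; simp

theorem withTopRank_chart {m : P} (e : Set.Icc ⊥ m ≃o Finset (Fin n)) {x : P} (hx : x ≤ m) :
    withTopRank P n x = (e ⟨x, bot_le, hx⟩).card := by
  rw [withTopRank_coe, height_eq_card_chart e hx]; rfl

theorem withTopRank_chart_symm {m : P} (e : Set.Icc ⊥ m ≃o Finset (Fin n)) (u : Finset (Fin n)) :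
    withTopRank P n ((e.symm u).1 : P) = u.card := by
  rw [withTopRank_chart e (e.symm u).2.2]
  change (e (e.symm u)).card = _
  rw [e.apply_symm_apply]

variable [Finite P]

theorem IsGradedSimplicial.exists_chart (hP : IsGradedSimplicial P n) (x : P) :
    ∃ m, x ≤ m ∧ Nonempty (Set.Icc ⊥ m ≃o Finset (Fin n)) := by
  obtain ⟨m, hm, hmax⟩ := Finite.exists_le_maximal (p := fun _ : P => True) (a := x) trivial
  exact ⟨m, hm, hP m (maximal_true.1 hmax)⟩

theorem IsGradedSimplicial.withTopRank_coe_le (hP : IsGradedSimplicial P n) (x : P) :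
    withTopRank P n x ≤ n := by
  obtain ⟨m, hx, ⟨e⟩⟩ := hP.exists_chart x
  rw [withTopRank_chart e hx]
  simpa using Finset.card_le_univ (e ⟨x, bot_le, hx⟩)

theorem IsGradedSimplicial.isRankFunction (hP : IsGradedSimplicial P n) :
    IsRankFunction (withTopRank P n) where
  strictMono x y hxy := by
    obtain ⟨x, rfl⟩ := WithTop.ne_top_iff_exists.1 (ne_top_of_lt hxy)
    induction y using WithTop.recTopCoe with
    | top =>
      have := hP.withTopRank_coe_le x
      rw [withTopRank_top]; omega
    | coe y =>
      obtain ⟨m, hy, ⟨e⟩⟩ := hP.exists_chart y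
      have hxy' := WithTop.coe_lt_coe.1 hxy
      rw [withTopRank_chart e hy, withTopRank_chart e (hxy'.le.trans hy)]
      exact Finset.card_lt_card (e.lt_iff_lt.2 hxy')
  exists_between x y hxy i hi hi' := by
    obtain ⟨x, rfl⟩ := WithTop.ne_top_iff_exists.1 (ne_top_of_lt hxy)
    induction y using WithTop.recTopCoe with
    | top =>
      obtain ⟨m, hx, ⟨e⟩⟩ := hP.exists_chart x
      rw [withTopRank_chart e hx] at hi
      rw [withTopRank_top] at hi'
      obtain ⟨u, hu, -, hc⟩ := Finset.exists_subsuperset_card_eq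
        (Finset.subset_univ (e ⟨x, bot_le, hx⟩)) hi.le (by simpa using by omega)
      refine ⟨((e.symm u).1 : P), ?_, WithTop.coe_lt_top _, by rw [withTopRank_chart_symm, hc]⟩
      rw [WithTop.coe_lt_coe]
      have : (⟨x, bot_le, hx⟩ : Set.Icc ⊥ m) < e.symm u := by
        rw [← e.lt_iff_lt, e.apply_symm_apply]
        exact Finset.ssubset_iff_subset_ne.2 ⟨hu, fun h => by rw [h, hc] at hi; omega⟩
      exact this
    | coe y =>
      obtain ⟨m, hy, ⟨e⟩⟩ := hP.exists_chart y
      have hxy' := WithTop.coe_lt_coe.1 hxy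
      have hx := hxy'.le.trans hy
      rw [withTopRank_chart e hx] at hi
      rw [withTopRank_chart e hy] at hi'
      obtain ⟨u, hu, hu', hc⟩ := Finset.exists_subsuperset_card_eq
        (show e ⟨x, bot_le, hx⟩ ⊆ e ⟨y, bot_le, hy⟩ from e.le_iff_le.2 hxy'.le) hi.le hi'.le
      refine ⟨((e.symm u).1 : P), ?_, ?_, by rw [withTopRank_chart_symm, hc]⟩
      · rw [WithTop.coe_lt_coe]
        have : (⟨x, bot_le, hx⟩ : Set.Icc ⊥ m) < e.symm u := by
          rw [← e.lt_iff_lt, e.apply_symm_apply]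
          exact Finset.ssubset_iff_subset_ne.2 ⟨hu, fun h => by rw [h, hc] at hi; omega⟩
        exact this
      · rw [WithTop.coe_lt_coe]
        have : e.symm u < (⟨y, bot_le, hy⟩ : Set.Icc ⊥ m) := by
          rw [← e.lt_iff_lt, e.apply_symm_apply]
          exact Finset.ssubset_iff_subset_ne.2 ⟨hu', fun h => by rw [← h, hc] at hi'; omega⟩
        exact this

theorem IsGradedSimplicial.card_lt_coe (hP : IsGradedSimplicial P n) (p : P) {t : ℕ}
    (ht : t < withTopRank P n p) :
    Nat.card {z : WithTop P // z < p ∧ withTopRank P n z = t} =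
      (withTopRank P n p).choose t := by
  obtain ⟨m, hp, ⟨e⟩⟩ := hP.exists_chart p
  rw [withTopRank_chart e hp] at ht ⊢
  classical
  have hinj : Function.Injective fun u => ((e.symm u).1 : WithTop P) := fun u v h =>
    e.symm.injective (Subtype.ext (WithTop.coe_injective h))
  rw [← Finset.card_powersetCard, ← Finset.card_image_of_injective _ hinj]
  refine Nat.subtype_card _ fun z => ?_
  simp only [Finset.mem_image, Finset.mem_powersetCard]
  constructor
  · rintro ⟨u, ⟨hu, hc⟩, rfl⟩
    refine ⟨?_, by rw [withTopRank_chart_symm, hc]⟩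
    rw [WithTop.coe_lt_coe]
    have : e.symm u < (⟨p, bot_le, hp⟩ : Set.Icc ⊥ m) := by
      rw [← e.lt_iff_lt, e.apply_symm_apply]
      exact Finset.ssubset_iff_subset_ne.2 ⟨hu, fun h => by rw [← h, hc] at ht; omega⟩
    exact this
  · rintro ⟨hz, hzt⟩
    obtain ⟨z, rfl⟩ := WithTop.ne_top_iff_exists.1 (ne_top_of_lt hz)
    have hzp := (WithTop.coe_lt_coe.1 hz).le
    refine ⟨e ⟨z, bot_le, hzp.trans hp⟩, ⟨e.le_iff_le.2 hzp, ?_⟩, by rw [e.symm_apply_apply]⟩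
    rw [← hzt, withTopRank_chart e (hzp.trans hp)]

theorem IsGradedSimplicial.card_lt_top (hP : IsGradedSimplicial P n) (t : ℕ) :
    Nat.card {z : WithTop P // z < ⊤ ∧ withTopRank P n z = t} = numOfRank P t := by
  have hh : ∀ p : P, Order.height p = (t : ℕ∞) ↔ withTopRank P n p = t := by
    intro p
    obtain ⟨m, hp, ⟨e⟩⟩ := hP.exists_chart p
    rw [withTopRank_chart e hp, height_eq_card_chart e hp, Nat.cast_inj]
  symm
  refine Nat.card_eq_of_bijective (fun p : {p : P // Order.height p = (t : ℕ∞)} =>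
    (⟨(p.1 : WithTop P), WithTop.coe_lt_top _, (hh p.1).1 p.2⟩ :
      {z : WithTop P // z < ⊤ ∧ withTopRank P n z = t})) ⟨fun p q h => ?_, fun z => ?_⟩
  · exact Subtype.ext (WithTop.coe_injective (congrArg Subtype.val h))
  · obtain ⟨z, hz, hzt⟩ := z
    obtain ⟨p, rfl⟩ := WithTop.ne_top_iff_exists.1 hz.ne
    exact ⟨⟨p, (hh p).2 hzt⟩, rfl⟩

/-- Below `p` the poset is Boolean, so both sides obey the same recursion on the largest element of
`T`. -/
theorem IsGradedSimplicial.chainCount_coe (hP : IsGradedSimplicial P n) (T : Finset ℕ)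
    (hT : ∀ t ∈ T, 0 < t) (p : P) (hp : 0 < withTopRank P n p)
    (hTp : ∀ t ∈ T, t < withTopRank P n p) :
    chainCount (withTopRank P n) (p : WithTop P) T = descentTotal (withTopRank P n p) T := by
  induction T using Finset.induction_on_max generalizing p with
  | empty => rw [IsRankFunction.chainCount_empty, descentTotal_empty hp]
  | insert t T hmax ih =>
    have ht := hT t (Finset.mem_insert_self _ _)
    have htp := hTp t (Finset.mem_insert_self _ _)
    rw [hP.isRankFunction.chainCount_insert p hmax (K := descentTotal t T),
      hP.card_lt_coe p htp, descentTotal_insert ht htp hmax]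
    intro z hz hzt
    obtain ⟨z, rfl⟩ := WithTop.ne_top_iff_exists.1 (ne_top_of_lt hz)
    rw [ih (fun i hi => hT i (Finset.mem_insert_of_mem hi)) z (by omega)
      (fun i hi => by rw [hzt]; exact hmax i hi), hzt]

theorem IsGradedSimplicial.flagF_eq_chainCount (hP : IsGradedSimplicial P n) {T : Finset ℕ}
    (hT : T ⊆ Finset.Icc 1 n) :
    flagF (WithTop P) T = chainCount (withTopRank P n) ⊤ T := by
  have hT' : ∀ i ∈ T, 0 < i ∧ i < n + 1 := fun i hi => by
    have := Finset.mem_Icc.1 (hT hi); omega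
  rw [hP.isRankFunction.flagF_eq withTopRank_bot hT', chainCount]
  refine Nat.card_congr (Equiv.subtypeEquivRight fun c => and_congr_right fun _ => ?_)
  refine ⟨fun h => ⟨h, fun y hy => ?_⟩, fun h => h.1⟩
  have : withTopRank P n y ∈ withTopRank P n '' c := ⟨y, hy, rfl⟩
  rw [h] at this
  refine lt_top_iff_ne_top.2 fun e => ?_
  have := hT' _ this
  rw [e, withTopRank_top] at this
  omega

/-- If `t` is the largest rank, there are `f_(t-1) = ∑ h_i C(n - i, n - t)` choices for the top of
the chain. The same binomial counts the increasing tails of permutations ending in `n - i`, so the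
remaining factors agree. -/
theorem IsGradedSimplicial.flagF_eq_sum (hP : IsGradedSimplicial P n) {T : Finset ℕ}
    (hT : T ⊆ Finset.Icc 1 n) : (flagF (WithTop P) T : ℤ) =
      ∑ i ∈ Finset.range (n + 1), hVector P n i * descentCountLE n (n - i) T := by
  rw [hP.flagF_eq_chainCount hT]
  induction T using Finset.induction_on_max with
  | empty =>
    have h0 := numOfRank_eq_sum_hVector P n (Nat.zero_le n)
    rw [numOfRank_zero] at h0
    rw [IsRankFunction.chainCount_empty, h0]
    simp [descentCountLE, descentCount_empty]
  | insert t T hmax _ =>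
    have ht := Finset.mem_Icc.1 (hT (Finset.mem_insert_self _ _))
    have hT0 : ∀ i ∈ T, 0 < i := fun i hi =>
      (Finset.mem_Icc.1 (hT (Finset.mem_insert_of_mem hi))).1
    rw [hP.isRankFunction.chainCount_insert ⊤ hmax (K := descentTotal t T), hP.card_lt_top,
      Nat.cast_mul, numOfRank_eq_sum_hVector P n ht.2, Finset.sum_mul]
    · refine Finset.sum_congr rfl fun i hi => ?_
      obtain ⟨r, rfl⟩ : ∃ r, n = t + r := ⟨n - t, by omega⟩
      rw [descentCountLE_insert_add ht.1 hmax r _ (by omega), Nat.add_sub_cancel_left]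
      push_cast; ring
    · intro z hz hzt
      obtain ⟨z, rfl⟩ := WithTop.ne_top_iff_exists.1 (ne_top_of_lt hz)
      rw [hP.chainCount_coe T hT0 z (by omega) (fun i hi => by rw [hzt]; exact hmax i hi), hzt]

/-- The flag `h`-vector of a graded simplicial poset as a combination of its `h`-vector. -/
theorem IsGradedSimplicial.flagH_eq_sum (hP : IsGradedSimplicial P n) {S : Finset ℕ}
    (hS : S ⊆ Finset.Icc 1 n) : flagH (WithTop P) S =
      ∑ i ∈ Finset.range (n + 1), hVector P n i * descentCount n (n - i) S := by
  rw [← sum_powerset_neg_one_pow_sdiff_mul_sum (fun S => ∑ i ∈ Finset.range (n + 1),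
    hVector P n i * (descentCount n (n - i) S : ℤ)) S, flagH]
  refine Finset.sum_congr rfl fun T hT => ?_
  rw [hP.flagF_eq_sum ((Finset.mem_powerset.1 hT).trans hS), Finset.sum_comm]
  simp [descentCountLE, Finset.mul_sum]

theorem IsGradedSimplicial.flagH_nonneg (hP : IsGradedSimplicial P n)
    (hpos : HasPositiveHVector P n) {S : Finset ℕ} (hS : S ⊆ Finset.Icc 1 n) :
    0 ≤ flagH (WithTop P) S := by
  rw [hP.flagH_eq_sum hS]
  refine Finset.sum_nonneg fun i hi => mul_nonneg (hpos i ?_) (by positivity)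
  have := Finset.mem_range.1 hi
  omega

theorem flagH_empty (Q : Type*) [PartialOrder Q] : flagH Q ∅ = 1 := by
  have : IsEmpty (RankSelected Q ∅) := ⟨fun x => by simpa using x.2⟩
  have : Nat.card (Flag (RankSelected Q ∅)) = 1 := by
    rw [Nat.card_eq_one_iff_unique]
    refine ⟨⟨fun a b => Flag.ext (Subsingleton.elim _ _)⟩,
      ⟨⟨∅, by simp [IsChain], fun s _ _ => Subsingleton.elim _ _⟩⟩⟩
  simp [flagH, flagF, this]

theorem IsGradedSimplicial.posetRank_withTop (hP : IsGradedSimplicial P n) :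
    posetRank (WithTop P) = n + 1 := by
  rw [posetRank, hP.isRankFunction.height_eq withTopRank_bot, withTopRank_top]; rfl

theorem IsGradedSimplicial.withTopRank_le (hP : IsGradedSimplicial P n) (x : WithTop P) :
    withTopRank P n x ≤ n + 1 :=
  hP.isRankFunction.strictMono.monotone le_top

theorem IsGradedSimplicial.posetRank_dual (hP : IsGradedSimplicial P n) :
    posetRank (WithTop P)ᵒᵈ = n + 1 := by
  rw [posetRank, (hP.isRankFunction.dual hP.withTopRank_le).height_eq (by simp)]
  simp [withTopRank_bot]

theorem IsGradedSimplicial.flagH_dual (hP : IsGradedSimplicial P n) {S : Finset ℕ}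
    (hS : S ⊆ Finset.Icc 1 n) :
    flagH (WithTop P)ᵒᵈ S = flagH (WithTop P) (S.image (n + 1 - ·)) :=
  hP.isRankFunction.flagH_dual withTopRank_bot withTopRank_top fun i hi => by
    have := Finset.mem_Icc.1 (hS hi); omega

end Simplicial

/-! ### Expansions in the γ-basis -/

/-- The polynomial with coefficients `c S` in the `γ`-basis, summed over isolated subsets of
`{1, …, b}`. -/
noncomputable def gammaSum (b m : ℕ) (c : Finset ℕ → ℝ) : ℝ[X] :=
  ∑ S ∈ isolatedSets 1 b, C (c S) * X ^ S.card * (1 + X) ^ (m - 2 * S.card)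

theorem aeval_gammaSum {b m : ℕ} (c : Finset ℕ → ℝ)
    (hcard : ∀ S ∈ isolatedSets 1 b, 2 * S.card ≤ m) {z : ℂ} (hz : 1 + z ≠ 0) :
    aeval z (gammaSum b m c) =
      (1 + z) ^ m * ∑ S ∈ isolatedSets 1 b, (c S : ℂ) * (z / (1 + z) ^ 2) ^ S.card := by
  rw [gammaSum, map_sum, Finset.mul_sum]
  refine Finset.sum_congr rfl fun S hS => ?_
  obtain ⟨r, hr⟩ := Nat.exists_eq_add_of_le (hcard S hS)
  simp only [map_mul, aeval_C, map_pow, aeval_X, map_add, map_one, Complex.coe_algebraMap]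
  rw [hr, Nat.add_sub_cancel_left, pow_add, pow_mul, div_pow]
  field_simp

theorem monic_one_add_X : (1 + X : ℝ[X]).Monic := by
  rw [add_comm]; exact monic_X_add_C 1

theorem natDegree_one_add_X_pow (m : ℕ) : ((1 + X : ℝ[X]) ^ m).natDegree = m := by
  rw [monic_one_add_X.natDegree_pow, add_comm, ← C_1, natDegree_X_add_C, mul_one]

/-- The term of `S` has degree at most `m - |S|`, so only `S = ∅` reaches degree `m`. -/
theorem gammaSum_monic_natDegree {b m : ℕ} (c : Finset ℕ → ℝ) (hc : c ∅ = 1)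
    (hcard : ∀ S ∈ isolatedSets 1 b, 2 * S.card ≤ m) :
    (gammaSum b m c).Monic ∧ (gammaSum b m c).natDegree = m := by
  classical
  have hsplit : gammaSum b m c = (1 + X) ^ m + ∑ S ∈ (isolatedSets 1 b).erase ∅,
      C (c S) * X ^ S.card * (1 + X) ^ (m - 2 * S.card) := by
    rw [gammaSum, ← Finset.add_sum_erase _ _ (empty_mem_isolatedSets 1 b)]
    simp [hc]
  have hmon : ((1 + X : ℝ[X]) ^ m).Monic := monic_one_add_X.pow m
  have hlt : (∑ S ∈ (isolatedSets 1 b).erase ∅,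
      C (c S) * X ^ S.card * (1 + X) ^ (m - 2 * S.card)).degree < ((1 + X : ℝ[X]) ^ m).degree := by
    rw [degree_eq_natDegree hmon.ne_zero, natDegree_one_add_X_pow]
    refine (degree_sum_le _ _).trans_lt ((Finset.sup_lt_iff (WithBot.bot_lt_coe m)).2 ?_)
    intro S hS
    have h1 := hcard S (Finset.mem_of_mem_erase hS)
    have h2 : 0 < S.card := Finset.card_pos.2
      (Finset.nonempty_iff_ne_empty.2 (Finset.ne_of_mem_erase hS))
    refine degree_le_natDegree.trans_lt ?_
    have : (C (c S) * X ^ S.card * (1 + X) ^ (m - 2 * S.card)).natDegree ≤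
        (0 + S.card) + (m - 2 * S.card) :=
      natDegree_mul_le_of_le (natDegree_mul_le_of_le (natDegree_C _).le (natDegree_X_pow_le _))
        (natDegree_one_add_X_pow _).le
    exact Nat.cast_lt.2 (this.trans_lt (by omega))
  rw [hsplit]
  exact ⟨hmon.add_of_left hlt, by
    rw [natDegree_add_eq_left_of_degree_lt hlt, natDegree_one_add_X_pow]⟩

theorem gammaSum_coeff_nonneg {b m : ℕ} (c : Finset ℕ → ℝ)
    (hc : ∀ S ∈ isolatedSets 1 b, 0 ≤ c S) (i : ℕ) : 0 ≤ (gammaSum b m c).coeff i := by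
  rw [gammaSum, finsetSum_coeff]
  refine Finset.sum_nonneg fun S hS => ?_
  rw [mul_assoc, coeff_C_mul, coeff_X_pow_mul']
  refine mul_nonneg (hc S hS) ?_
  split_ifs
  · rw [coeff_one_add_X_pow]; positivity
  · exact le_rfl

theorem two_mul_card_le_succ {b : ℕ} : ∀ S ∈ isolatedSets 1 b, 2 * S.card ≤ b + 1 := fun _ hS =>
  IsIsolated.two_mul_card_le (by omega) hS

theorem two_mul_card_le_of_pred {n : ℕ} : ∀ S ∈ isolatedSets 1 (n - 1), 2 * S.card ≤ n :=
  fun S hS => by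
    have := two_mul_card_le_succ S hS
    omega

theorem image_sub_mem_isolatedSets {a b n : ℕ} (hb : b ≤ n) {S : Finset ℕ}
    (hS : S ∈ isolatedSets a b) : S.image (n - ·) ∈ isolatedSets (n - b) (n - a) := by
  obtain ⟨h, hi⟩ := mem_isolatedSets.1 hS
  refine mem_isolatedSets.2 ⟨fun x hx => ?_, fun x hx hx' => ?_⟩
  · obtain ⟨j, hj, rfl⟩ := Finset.mem_image.1 hx
    have := Finset.mem_Icc.1 (h hj)
    exact Finset.mem_Icc.2 (by omega)
  · obtain ⟨j, hj, rfl⟩ := Finset.mem_image.1 hx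
    obtain ⟨k, hk, e⟩ := Finset.mem_image.1 hx'
    have h1 := Finset.mem_Icc.1 (h hj)
    have h2 := Finset.mem_Icc.1 (h hk)
    have : k + 1 = j := by omega
    exact hi k hk (this ▸ hj)

theorem image_sub_image_sub {n : ℕ} {S : Finset ℕ} (hS : ∀ i ∈ S, i ≤ n) :
    (S.image (n - ·)).image (n - ·) = S := by
  rw [Finset.image_image]
  refine (Finset.image_congr fun i hi => ?_).trans Finset.image_id
  exact Nat.sub_sub_self (hS i hi)

theorem sum_isolatedSets_reflect {M : Type*} [AddCommMonoid M] {a b n : ℕ} (ha : a ≤ n) (hb : b ≤ n)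
    (F : Finset ℕ → M) : ∑ S ∈ isolatedSets a b, F (S.image (n - ·)) =
      ∑ S ∈ isolatedSets (n - b) (n - a), F S := by
  have hle : ∀ {a b}, b ≤ n → ∀ S ∈ isolatedSets a b, ∀ i ∈ S, i ≤ n := fun hb S hS i hi =>
    (Finset.mem_Icc.1 ((mem_isolatedSets.1 hS).1 hi)).2.trans hb
  refine Finset.sum_bij' (fun S _ => S.image (n - ·)) (fun S _ => S.image (n - ·))
    (fun S hS => image_sub_mem_isolatedSets hb hS) (fun S hS => ?_)
    (fun S hS => image_sub_image_sub (hle hb S hS))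
    (fun S hS => image_sub_image_sub (hle (Nat.sub_le _ _) S hS)) fun _ _ => rfl
  have := image_sub_mem_isolatedSets (Nat.sub_le n a) hS
  rwa [Nat.sub_sub_self ha, Nat.sub_sub_self hb] at this

section Simplicial

variable {P : Type*} [PartialOrder P] [OrderBot P] [Finite P] {n : ℕ}

theorem card_image_sub {a b n : ℕ} (hb : b ≤ n) {S : Finset ℕ} (hS : S ∈ isolatedSets a b) :
    (S.image (n - ·)).card = S.card := by
  refine Finset.card_image_of_injOn fun i hi j hj e => ?_
  have h1 := Finset.mem_Icc.1 ((mem_isolatedSets.1 hS).1 hi)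
  have h2 := Finset.mem_Icc.1 ((mem_isolatedSets.1 hS).1 hj)
  omega

theorem IsGradedSimplicial.chowPolynomial_dual (hP : IsGradedSimplicial P n) :
    chowPolynomial (WithTop P)ᵒᵈ = gammaSum (n - 1) n fun S => flagH (WithTop P) S := by
  rw [chowPolynomial, hP.posetRank_dual, Nat.add_sub_cancel]
  change ∑ S ∈ isolatedSets 2 n, _ = _
  -- For `n = 0` the reflection lemma would need `2 ≤ n + 1`; both sums then reduce to `S = ∅`.
  rcases Nat.eq_zero_or_pos n with rfl | hn
  · rw [gammaSum, isolatedSets_one_zero]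
    have : isolatedSets 2 0 = {∅} := by
      ext S
      simp only [mem_isolatedSets, Finset.mem_singleton]
      exact ⟨fun h => by simpa using h.1, fun h => mem_isolatedSets.1 (h ▸ empty_mem_isolatedSets 2 0)⟩
    rw [this]
    simp [flagH_empty]
  · have hr := sum_isolatedSets_reflect (a := 2) (b := n) (n := n + 1) (by omega) (by omega)
      fun S => C (flagH (WithTop P) S : ℝ) * X ^ S.card * (1 + X) ^ (n - 2 * S.card)
    rw [show n + 1 - n = 1 by omega, show n + 1 - 2 = n - 1 by omega] at hr
    rw [gammaSum, ← hr]
    refine Finset.sum_congr rfl fun S hS => ?_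
    rw [hP.flagH_dual ((mem_isolatedSets.1 hS).1.trans (Finset.Icc_subset_Icc_left (by omega))),
      card_image_sub (by omega) hS]

theorem IsGradedSimplicial.augChowPolynomial_dual (hP : IsGradedSimplicial P n) :
    augChowPolynomial (WithTop P)ᵒᵈ = gammaSum n (n + 1) fun S => flagH (WithTop P) S := by
  rw [augChowPolynomial, hP.posetRank_dual, Nat.add_sub_cancel]
  change ∑ S ∈ isolatedSets 1 n, _ = _
  have hr := sum_isolatedSets_reflect (a := 1) (b := n) (n := n + 1) (by omega) (by omega)
    fun S => C (flagH (WithTop P) S : ℝ) * X ^ S.card * (1 + X) ^ (n + 1 - 2 * S.card)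
  rw [show n + 1 - n = 1 by omega, Nat.add_sub_cancel] at hr
  rw [gammaSum, ← hr]
  refine Finset.sum_congr rfl fun S hS => ?_
  rw [hP.flagH_dual (mem_isolatedSets.1 hS).1, card_image_sub (by omega) hS]

theorem IsGradedSimplicial.augChowPolynomial_withTop (hP : IsGradedSimplicial P n) :
    augChowPolynomial (WithTop P) = gammaSum n (n + 1) fun S => flagH (WithTop P) S := by
  rw [augChowPolynomial, hP.posetRank_withTop, Nat.add_sub_cancel]
  rfl

theorem IsGradedSimplicial.sum_flagH_mul_pow (hP : IsGradedSimplicial P n) {b : ℕ} (hb : b ≤ n)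
    (y : ℂ) : ∑ S ∈ isolatedSets 1 b, ((flagH (WithTop P) S : ℝ) : ℂ) * y ^ S.card =
      ∑ k ∈ Finset.range (n + 1), ((hVector P n (n - k) : ℝ) : ℂ) *
        isolatedDescentSum b n k y := by
  rw [← Finset.sum_range_reflect]
  simp only [isolatedDescentSum, Finset.mul_sum]
  rw [Finset.sum_comm]
  refine Finset.sum_congr rfl fun S hS => ?_
  rw [hP.flagH_eq_sum ((mem_isolatedSets.1 hS).1.trans (Finset.Icc_subset_Icc_right hb))]
  push_cast
  rw [Finset.sum_mul]
  refine Finset.sum_congr rfl fun i hi => ?_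
  have := Finset.mem_range.1 hi
  rw [Nat.sub_sub_self (by omega)]
  ring

end Simplicial

/-! ### The upper half plane estimate and the conclusion -/

/-- The map `z ↦ (1 + z) * (s + t * z / (1 + z) ^ 2)` preserves the upper half plane. -/
theorem im_one_add_mul_pos {z : ℂ} (hz : 0 < z.im) {s t : ℝ} (hs : 0 < s) (ht : 0 ≤ t) :
    0 < ((1 + z) * (s + t * (z / (1 + z) ^ 2))).im := by
  have hw : 1 + z ≠ 0 := fun h => by
    have := congrArg Complex.im h
    simp at this; exact hz.ne' this
  have hpos : 0 < Complex.normSq (1 + z) := Complex.normSq_pos.2 hw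
  have e : (1 + z) * (s + t * (z / (1 + z) ^ 2)) = s * (1 + z) + t * (1 - (1 + z)⁻¹) := by
    field_simp; ring
  rw [e, Complex.add_im, Complex.im_ofReal_mul, Complex.im_ofReal_mul, Complex.sub_im,
    Complex.inv_im]
  have h1 : (1 + z).im = z.im := by simp
  rw [h1, Complex.one_im]
  have h2 : 0 < z.im / Complex.normSq (1 + z) := by positivity
  have h3 : 0 ≤ t * (0 - -z.im / Complex.normSq (1 + z)) := by
    refine mul_nonneg ht ?_
    rw [neg_div]; linarith
  nlinarith [mul_pos hs hz]

theorem div_sq_ne_neg {z : ℂ} (hz : 0 < z.im) (r : ℝ) (hr : 0 < r) : z / (1 + z) ^ 2 ≠ -r := by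
  intro h
  -- If `z / (1 + z)^2 = -r`, adding `r / 2` still leaves the negative multiple `-(r / 2)(1 + z)`,
  -- whose imaginary part is negative.
  have := im_one_add_mul_pos hz (s := r / 2) (t := 1) (by positivity) zero_le_one
  rw [h, show (1 + z) * (((r / 2 : ℝ) : ℂ) + ((1 : ℝ) : ℂ) * -(r : ℂ)) =
    ((-(r / 2) : ℝ) : ℂ) * (1 + z) by push_cast; ring, Complex.im_ofReal_mul] at this
  have h1 : (1 + z).im = z.im := by simp
  rw [h1] at this
  nlinarith

theorem theorem2 {P : Type*} [PartialOrder P] [OrderBot P] [Finite P] (n : ℕ)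
    (hP : IsGradedSimplicial P n) (hpos : HasPositiveHVector P n) :
    IsRealRooted (chowPolynomial (WithTop P)ᵒᵈ) ∧
    Interlaces (chowPolynomial (WithTop P)ᵒᵈ) (augChowPolynomial (WithTop P)ᵒᵈ) ∧
    augChowPolynomial (WithTop P)ᵒᵈ = augChowPolynomial (WithTop P) := by
  rw [← and_assoc]
  refine ⟨?_, hP.augChowPolynomial_dual.trans hP.augChowPolynomial_withTop.symm⟩
  rw [hP.chowPolynomial_dual, hP.augChowPolynomial_dual]
  have hempty : (flagH (WithTop P) ∅ : ℝ) = 1 := by rw [flagH_empty]; simp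
  obtain ⟨hf, hfd⟩ := gammaSum_monic_natDegree (fun S => (flagH (WithTop P) S : ℝ)) hempty
    (two_mul_card_le_of_pred (n := n))
  obtain ⟨hg, hgd⟩ := gammaSum_monic_natDegree (fun S => (flagH (WithTop P) S : ℝ)) hempty
    (two_mul_card_le_succ (b := n))
  have hnonneg : ∀ b ≤ n, ∀ S ∈ isolatedSets 1 b, (0 : ℝ) ≤ flagH (WithTop P) S := by
    intro b hb S hS
    exact_mod_cast hP.flagH_nonneg hpos
      ((mem_isolatedSets.1 hS).1.trans (Finset.Icc_subset_Icc_right hb))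
  refine interlaces_of_im_pos hf hg (by rw [hfd, hgd])
    (gammaSum_coeff_nonneg _ (hnonneg _ (Nat.sub_le n 1))) (gammaSum_coeff_nonneg _ (hnonneg n le_rfl))
    fun z hz => ?_
  have hw : 1 + z ≠ 0 := fun h => by
    have := congrArg Complex.im h
    simp at this; exact hz.ne' this
  -- The weight at `k = n` is `h_0 = 1`, which supplies the strict positivity.
  obtain ⟨s, t, hs, ht, e⟩ := isolatedDescentSum_mul_conj (div_sq_ne_neg hz) n
    (fun k => (hVector P n (n - k) : ℝ))
    (fun k _ => by exact_mod_cast hpos (n - k) (Nat.sub_le _ _))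
    (by simp [hVector_zero])
  rw [← hP.sum_flagH_mul_pow le_rfl, ← hP.sum_flagH_mul_pow (Nat.sub_le n 1)] at e
  -- The product becomes `|1 + z|^(2n)` times `(1 + z)(s + t y)`; the extra factor `1 + z` comes
  -- from the degree difference.
  rw [aeval_gammaSum _ two_mul_card_le_succ hw, aeval_gammaSum _ two_mul_card_le_of_pred hw,
    map_mul, mul_mul_mul_comm, e, map_pow, pow_succ, mul_right_comm ((1 + z) ^ n), ← mul_pow,
    Complex.mul_conj, mul_assoc, ← Complex.ofReal_pow, Complex.im_ofReal_mul]
  exact mul_pos (pow_pos (Complex.normSq_pos.2 hw) n) (im_one_add_mul_pos hz hs ht)
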